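/- Let $A$ be a $C^*$-algebra and let $A^{**}$ be its enveloping von Neumann algebra (equivalently its bidual), i.e. the double commutant $\pi_u(A)''$ of $A$ in its universal representation $\pi_u$, the direct sum of the GNS representations of all states of $A$; we regard $A\subset A^{**}$ through $\pi_u$. Hilbert modules are right modules with inner products linear in the second variable. For a Hilbert $A$-module $H$ let $H\bullet A^{**}$ be the Hilbert $A^{**}$-module obtained by completing $(H\otimes A^{**})/N$, where $H\otimes A^{**}$ is the algebraic tensor product over $\mathbb{C}$ with $\langle h\otimes a,\,x\otimes b\rangle=a^*\langle h,x\rangle b$ and $N=\{z:\langle z,z\rangle=0\}$. For a Hilbert $A^{**}$-module $E$ let $E^\sharp$ be the Banach space of all bounded $A^{**}$-module maps $f:E\to A^{**}$ with the operator norm, with scalar multiplication $(\lambda f)(x)=\bar\lambda f(x)$ and right action $(f\cdot a)(x)=a^*f(x)$, so that $x\mapsto\hat x=\langle x,\cdot\rangle$ is a linear module map $E\to E^\sharp$; $E$ is self-dual if every $f\in E^\sharp$ is of the form $\hat x$. Put $H^\sim=(H\bullet A^{**})^\sharp$, and map $H$ to $H^\sim$ by $x\mapsto\widehat{x\otimes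 1}$. Then $H^\sim$ is the smallest self-dual Hilbert $A^{**}$-module containing $H$ as a Hilbert $A$-submodule. Precisely: (1) $H^\sim$, with its operator norm, is complete and carries an $A^{**}$-valued inner product which induces this norm, satisfies $\langle f,\hat x\rangle=f(x)$ for all $f\in H^\sim$ and $x\in H\bullet A^{**}$, and makes $H^\sim$ a self-dual Hilbert $A^{**}$-module; the map $x\mapsto\widehat{x\otimes 1}$ is a linear $A$-module map $H\to H^\sim$ that preserves inner products. (2) With this inner product, let $H_1$ be any self-dual Hilbert $A^{**}$-module and $\iota:H\to H_1$ a linear $A$-module map with $\langle\iota(x),\iota(y)\rangle=\langle x,y\rangle$ for all $x,y\in H$. Then there is a unique linear $A^{**}$-module map $j:H^\sim\to H_1$ which preserves inner products and satisfies $j(\widehat{x\otimes 1})=\iota(x)$ for all $x\in H$. Moreover $j(H^\sim)$ is an orthogonal summand of $H_1$, i.e. $H_1=j(H^\sim)\oplus j(H^\sim)^\perp$. -/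

import Mathlib

open scoped TensorProduct RightActions ComplexOrder InnerProductSpace
open UniformSpace

set_option linter.unusedSectionVars false
set_option linter.unusedVariables false

/-! ## Hilbert modules (right modules, inner product linear in the second variable) -/

/-- A (right) pre-Hilbert module `E` over a C⋆-algebra `A`.  The right action of `a` on `x` is
written `x <• a`.  The norm of `E` is required to be the one given by the inner product, so a
Hilbert `A`-module is a pre-Hilbert module which is moreover a `CompleteSpace`. -/
class PreHilbertModule (A : Type*) (E : Type*) [NonUnitalCStarAlgebra A] [PartialOrder A]
    [NormedAddCommGroup E] [NormedSpace ℂ E] [SMul Aᵐᵒᵖ E] extends Inner A E where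
  add_act (x y : E) (a : A) : (x + y) <• a = x <• a + y <• a
  act_add (x : E) (a b : A) : x <• (a + b) = x <• a + x <• b
  act_mul (x : E) (a b : A) : x <• (a * b) = (x <• a) <• b
  smul_act (c : ℂ) (x : E) (a : A) : (c • x) <• a = c • (x <• a)
  act_smul (c : ℂ) (x : E) (a : A) : x <• (c • a) = c • (x <• a)
  inner_add_right (x y z : E) : inner x (y + z) = inner x y + inner x z
  inner_smul_right (c : ℂ) (x y : E) : inner x (c • y) = c • inner x y
  inner_act_right (x y : E) (a : A) : inner x (y <• a) = inner x y * a
  star_inner (x y : E) : star (inner x y) = inner y x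
  inner_self_nonneg (x : E) : 0 ≤ inner x x
  eq_zero_of_inner_self (x : E) : inner x x = 0 → x = 0
  norm_sq_eq (x : E) : ‖x‖ ^ 2 = ‖inner x x‖

section Dual

variable (A : Type*) (E : Type*) [NonUnitalCStarAlgebra A]
  [NormedAddCommGroup E] [NormedSpace ℂ E] [SMul Aᵐᵒᵖ E]

/-- The bounded `A`-module maps from `E` to `A`. -/
def moduleMaps : AddSubgroup (E →L[ℂ] A) where
  carrier := {f | ∀ (x : E) (a : A), f (x <• a) = f x * a}
  add_mem' {f g} hf hg x a := by simp [hf x a, hg x a, add_mul]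
  zero_mem' x a := by simp
  neg_mem' {f} hf x a := by simp [hf x a]

/-- The dual module `E^♯` of all bounded `A`-module maps from `E` to `A`, with the operator norm.
To make `E^♯` a right `A`-module into which `E` embeds linearly by `x ↦ ⟨x, ·⟩`, scalars act by
`(c • f) x = conj c * f x` and `A` acts by `(f <• a) x = star a * f x`. -/
def SharpDual : Type _ := ↥(moduleMaps A E)

namespace SharpDual

noncomputable instance : NormedAddCommGroup (SharpDual A E) :=
  inferInstanceAs (NormedAddCommGroup ↥(moduleMaps A E))

variable {A E}

instance : FunLike (SharpDual A E) E A where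
  coe f := f.1
  coe_injective f g h := Subtype.ext (DFunLike.coe_injective h)

@[ext] theorem ext {f g : SharpDual A E} (h : ∀ x, f x = g x) : f = g := DFunLike.ext f g h

theorem map_act (f : SharpDual A E) (x : E) (a : A) : f (x <• a) = f x * a := f.2 x a

@[simp] theorem add_apply (f g : SharpDual A E) (x : E) : (f + g) x = f x + g x := rfl
@[simp] theorem zero_apply (x : E) : (0 : SharpDual A E) x = 0 := rfl

theorem norm_def (f : SharpDual A E) : ‖f‖ = ‖f.1‖ := rfl

noncomputable instance : SMul ℂ (SharpDual A E) where
  smul c f := ⟨star c • f.1, fun x a => by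
    simp [f.2 x a, smul_mul_assoc]⟩

@[simp] theorem smul_apply (c : ℂ) (f : SharpDual A E) (x : E) : (c • f) x = star c • f x := rfl

noncomputable instance : Module ℂ (SharpDual A E) where
  one_smul f := by ext x; simp
  mul_smul c d f := by ext x; simp [mul_smul]
  smul_zero c := by ext x; simp
  smul_add c f g := by ext x; simp
  add_smul c d f := by ext x; simp [add_smul]
  zero_smul f := by ext x; simp

noncomputable instance : NormedSpace ℂ (SharpDual A E) where
  norm_smul_le c f := by
    rw [norm_def, norm_def]
    change ‖star c • f.1‖ ≤ _
    rw [norm_smul, norm_star]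

noncomputable instance : SMul Aᵐᵒᵖ (SharpDual A E) where
  smul a f := ⟨(ContinuousLinearMap.mul ℂ A (star a.unop)).comp f.1, fun x b => by
    simp [f.2 x b, mul_assoc]⟩

@[simp] theorem act_apply (f : SharpDual A E) (a : A) (x : E) : (f <• a) x = star a * f x := rfl

end SharpDual

end Dual

section SelfDual

variable (A : Type*) (E : Type*) [NonUnitalCStarAlgebra A] [PartialOrder A]
  [NormedAddCommGroup E] [NormedSpace ℂ E] [SMul Aᵐᵒᵖ E] [PreHilbertModule A E]

/-- Every bounded module map `E → A` is of the form `y ↦ ⟨x, y⟩` for some `x` in `E`. -/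
def IsSelfDual : Prop := ∀ f : SharpDual A E, ∃ x : E, ∀ y : E, f y = inner A x y

variable {E} in
/-- `W` is an orthogonal summand of `E`, that is `E = W ⊕ W^⊥`. -/
def IsOrthogonalSummand (W : Submodule ℂ E) : Prop :=
  ∀ x : E, ∃ w ∈ W, ∀ v ∈ W, inner A (x - w) v = 0

end SelfDual

/-- A linear map `ι : E → F` from a Hilbert `A`-module to a Hilbert `B`-module is an embedding of
Hilbert modules, where `A` acts on `F` through `φ : A → B`. -/
structure IsHilbertEmbedding {A B E F : Type*}
    [NonUnitalCStarAlgebra A] [PartialOrder A]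
    [NormedAddCommGroup E] [NormedSpace ℂ E] [SMul Aᵐᵒᵖ E] [PreHilbertModule A E]
    [NonUnitalCStarAlgebra B] [PartialOrder B]
    [NormedAddCommGroup F] [NormedSpace ℂ F] [SMul Bᵐᵒᵖ F] [PreHilbertModule B F]
    (φ : A →⋆ₙₐ[ℂ] B) (ι : E →ₗ[ℂ] F) : Prop where
  map_act (x : E) (a : A) : ι (x <• a) = ι x <• φ a
  inner_map (x y : E) : inner B (ι x) (ι y) = φ (inner A x y)

namespace PreHilbertModule

section Basic

variable {A E : Type*} [NonUnitalCStarAlgebra A] [PartialOrder A]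
  [NormedAddCommGroup E] [NormedSpace ℂ E] [SMul Aᵐᵒᵖ E] [PreHilbertModule A E]

theorem inner_add_left (x y z : E) : inner A (x + y) z = inner A x z + inner A y z := by
  rw [← star_inner, inner_add_right, star_add, star_inner, star_inner]

theorem inner_smul_left (c : ℂ) (x y : E) : inner A (c • x) y = star c • inner A x y := by
  rw [← star_inner, inner_smul_right, star_smul, star_inner]

theorem inner_act_left (x y : E) (a : A) : inner A (x <• a) y = star a * inner A x y := by
  rw [← star_inner, inner_act_right, star_mul, star_inner]

/-- The inner product as a sesquilinear map. -/
noncomputable def innerₛₗ : E →ₗ⋆[ℂ] E →ₗ[ℂ] A :=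
  LinearMap.mk₂'ₛₗ (starRingEnd ℂ) (RingHom.id ℂ) (fun x y => inner A x y)
    inner_add_left (fun c x y => inner_smul_left c x y) inner_add_right
    (fun c x y => inner_smul_right c x y)

theorem innerₛₗ_apply (x y : E) : innerₛₗ x y = inner A x y := rfl

end Basic

end PreHilbertModule

/-! ## A Cauchy-Schwarz inequality for semi-inner products -/

theorem norm_le_of_star_mul_self_le {B : Type*} [NonUnitalCStarAlgebra B] [PartialOrder B]
    [StarOrderedRing B] {p q r : B} (hq : 0 ≤ q) (hr : 0 ≤ r)
    (h : ∀ s : ℝ, 0 ≤ r - (2 * s) • (star p * p) + s ^ 2 • (star p * q * p)) :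
    ‖p‖ ^ 2 ≤ ‖q‖ * ‖r‖ := by
  have key : ∀ c : ℝ, ‖q‖ < c → ‖p‖ ^ 2 ≤ c * ‖r‖ := by
    intro c hc
    have hc0 : 0 < c := (norm_nonneg q).trans_lt hc
    have h1 : star p * q * p ≤ c • (star p * p) :=
      (CStarAlgebra.star_left_conjugate_le_norm_smul (a := p) (b := q)).trans
        (smul_le_smul_of_nonneg_right hc.le (star_mul_self_nonneg p))
    have h2 : c⁻¹ ^ 2 • (star p * q * p) ≤ c⁻¹ ^ 2 • (c • (star p * p)) :=
      smul_le_smul_of_nonneg_left h1 (by positivity)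
    have h3 : c⁻¹ ^ 2 • (c • (star p * p)) = c⁻¹ • (star p * p) := by
      rw [smul_smul]; congr 1; field_simp
    have h4 : 0 ≤ r - c⁻¹ • (star p * p) := by
      refine (h c⁻¹).trans ?_
      have : r - c⁻¹ • (star p * p)
          = r - (2 * c⁻¹) • (star p * p) + c⁻¹ • (star p * p) := by
        rw [two_mul, add_smul]; abel
      rw [this]
      gcongr
      exact h2.trans h3.le
    have h5 : c⁻¹ • (star p * p) ≤ r := sub_nonneg.mp h4
    have h6 : ‖c⁻¹ • (star p * p)‖ ≤ ‖r‖ :=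
      CStarAlgebra.norm_le_norm_of_nonneg_of_le
        (smul_nonneg (by positivity) (star_mul_self_nonneg p)) h5
    rw [norm_smul, CStarRing.norm_star_mul_self, Real.norm_of_nonneg (by positivity)] at h6
    rw [inv_mul_le_iff₀ hc0] at h6
    rwa [sq]
  have hlim : Filter.Tendsto (fun c : ℝ => c * ‖r‖) (nhdsWithin ‖q‖ (Set.Ioi ‖q‖))
      (nhds (‖q‖ * ‖r‖)) :=
    ((continuous_id.mul continuous_const).tendsto _).mono_left nhdsWithin_le_nhds
  exact ge_of_tendsto hlim (Filter.eventually_of_mem self_mem_nhdsWithin fun c hc => key c hc)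

namespace PreHilbertModule

variable {A E : Type*} [NonUnitalCStarAlgebra A] [PartialOrder A] [StarOrderedRing A]
  [NormedAddCommGroup E] [NormedSpace ℂ E] [SMul Aᵐᵒᵖ E] [PreHilbertModule A E]

theorem norm_inner_le (x y : E) : ‖(inner A x y : A)‖ ≤ ‖x‖ * ‖y‖ := by
  refine le_of_sq_le_sq ?_ (by positivity)
  rw [mul_pow, norm_sq_eq (A := A) x, norm_sq_eq (A := A) y]
  refine norm_le_of_star_mul_self_le (inner_self_nonneg x) (inner_self_nonneg y) fun s => ?_
  have h := inner_self_nonneg (A := A) (y - (s : ℂ) • (x <• (inner A x y : A)))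
  have e : inner A (y - (s : ℂ) • (x <• (inner A x y : A)))
        (y - (s : ℂ) • (x <• (inner A x y : A)))
      = inner A y y - (2 * s) • (star (inner A x y) * inner A x y)
        + s ^ 2 • (star (inner A x y) * inner A x x * inner A x y) := by
    rw [← innerₛₗ_apply]
    simp only [map_sub, LinearMap.sub_apply, map_smul, LinearMap.map_smulₛₗ, LinearMap.smul_apply,
      innerₛₗ_apply, inner_act_right, inner_act_left, Complex.conj_ofReal, star_inner]
    simp only [Complex.coe_smul]
    module
  rwa [e] at h

variable (A E) in
/-- The canonical map `E → E^♯`, `x ↦ ⟨x, ·⟩`. -/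
noncomputable def toSharpDual : E →ₗ[ℂ] SharpDual A E where
  toFun x := ⟨(innerₛₗ (A := A) x).mkContinuous ‖x‖ fun y => norm_inner_le x y,
    fun y a => inner_act_right x y a⟩
  map_add' x y := by ext z; exact inner_add_left x y z
  map_smul' c x := by ext z; exact inner_smul_left c x z

theorem toSharpDual_apply (x y : E) : toSharpDual A E x y = inner A x y := rfl

end PreHilbertModule

/-! ## The Hilbert module `H • B` -/

section Extension

variable {A B : Type*} [NonUnitalCStarAlgebra A] [PartialOrder A] [NonUnitalCStarAlgebra B] (φ : A →⋆ₙₐ[ℂ] B)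
  (H : Type*) [NormedAddCommGroup H] [NormedSpace ℂ H] [SMul Aᵐᵒᵖ H] [PreHilbertModule A H]

/-- The algebraic tensor product `H ⊗ B`, to be given the semi-inner product determined by
`⟨h ⊗ a, x ⊗ b⟩ = star a * φ ⟨h, x⟩ * b`. -/
@[nolint unusedArguments]
def AlgExtension (_φ : A →⋆ₙₐ[ℂ] B) (H : Type*) [NormedAddCommGroup H] [NormedSpace ℂ H] :
    Type _ := H ⊗[ℂ] B

namespace AlgExtension

noncomputable instance : AddCommGroup (AlgExtension φ H) :=
  inferInstanceAs (AddCommGroup (H ⊗[ℂ] B))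
noncomputable instance : Module ℂ (AlgExtension φ H) := inferInstanceAs (Module ℂ (H ⊗[ℂ] B))

variable {H} in
/-- The elementary tensor `h ⊗ b`. -/
def tmul (h : H) (b : B) : AlgExtension φ H := h ⊗ₜ[ℂ] b

/-- For fixed `h` and `a` the linear map `x ⊗ b ↦ star a * φ ⟨h, x⟩ * b`. -/
noncomputable def formAux : H →ₗ⋆[ℂ] B →ₗ⋆[ℂ] (H ⊗[ℂ] B →ₗ[ℂ] B) :=
  LinearMap.mk₂'ₛₗ (starRingEnd ℂ) (starRingEnd ℂ)
    (fun h a => TensorProduct.lift (LinearMap.mk₂ ℂ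
      (fun x b => star a * φ (inner A h x) * b)
      (by intros; simp [PreHilbertModule.inner_add_right, mul_add, add_mul])
      (by intros; simp [PreHilbertModule.inner_smul_right, mul_smul_comm, smul_mul_assoc])
      (by intros; simp [mul_add])
      (by intros; simp [mul_smul_comm])))
    (by intros; ext; simp [PreHilbertModule.inner_add_left, mul_add, add_mul])
    (by intros; ext; simp [PreHilbertModule.inner_smul_left, mul_smul_comm, smul_mul_assoc])
    (by intros; ext; simp [add_mul])
    (by intros; ext; simp [smul_mul_assoc])

/-- The semi-inner product on `H ⊗ B`. -/
noncomputable def form : AlgExtension φ H →ₗ⋆[ℂ] AlgExtension φ H →ₗ[ℂ] B :=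
  TensorProduct.lift (formAux φ H)

variable {H}

@[simp] theorem form_tmul (h x : H) (a b : B) :
    form φ H (tmul φ h a) (tmul φ x b) = star a * φ (inner A h x) * b := rfl

@[elab_as_elim]
theorem induction {P : AlgExtension φ H → Prop} (z : AlgExtension φ H) (h0 : P 0)
    (ht : ∀ h b, P (tmul φ h b)) (ha : ∀ x y, P x → P y → P (x + y)) : P z :=
  TensorProduct.induction_on z h0 ht ha

theorem star_form (z w : AlgExtension φ H) : star (form φ H z w) = form φ H w z := by
  induction z using induction with
  | h0 => simp
  | ha x y hx hy => simp [hx, hy]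
  | ht h a =>
    induction w using induction with
    | h0 => simp
    | ha x y hx hy => simp [hx, hy]
    | ht x b => simp [← map_star, PreHilbertModule.star_inner, mul_assoc]

/-- The right action of `b` on `H ⊗ B`, with `(h ⊗ a) b = h ⊗ ab`. -/
noncomputable def act (b : B) : AlgExtension φ H →ₗ[ℂ] AlgExtension φ H :=
  LinearMap.lTensor H (LinearMap.mulRight ℂ b)

@[simp] theorem act_tmul (h : H) (a b : B) : act φ b (tmul φ h a) = tmul φ h (a * b) := rfl

theorem act_add (z : AlgExtension φ H) (a b : B) : act φ (a + b) z = act φ a z + act φ b z := by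
  induction z using induction with
  | h0 => simp
  | ha x y hx hy => rw [map_add, map_add, map_add, hx, hy]; abel
  | ht h c =>
    rw [act_tmul, act_tmul, act_tmul, mul_add]
    exact TensorProduct.tmul_add h (c * a) (c * b)

theorem act_mul (z : AlgExtension φ H) (a b : B) : act φ (a * b) z = act φ b (act φ a z) := by
  induction z using induction with
  | h0 => simp
  | ha x y hx hy => simp only [map_add, hx, hy]
  | ht h c => simp [mul_assoc]

theorem act_smul (z : AlgExtension φ H) (c : ℂ) (b : B) : act φ (c • b) z = c • act φ b z := by
  induction z using induction with
  | h0 => simp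
  | ha x y hx hy => simp only [map_add, hx, hy, smul_add]
  | ht h d =>
    rw [act_tmul, act_tmul, mul_smul_comm]
    exact TensorProduct.tmul_smul c h (d * b)

theorem form_act_right (z w : AlgExtension φ H) (b : B) :
    form φ H z (act φ b w) = form φ H z w * b := by
  induction z using induction with
  | h0 => simp
  | ha x y hx hy => simp [hx, hy, add_mul]
  | ht h a =>
    induction w using induction with
    | h0 => simp
    | ha x y hx hy => simp [hx, hy, add_mul]
    | ht x c => simp [mul_assoc]

theorem form_act_left (z w : AlgExtension φ H) (b : B) :
    form φ H (act φ b z) w = star b * form φ H z w := by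
  rw [← star_form, form_act_right, star_mul, star_form]

section Positivity

theorem exists_neg_part {C : Type*} [NonUnitalCStarAlgebra C] (G : C) (hG : IsSelfAdjoint G) :
    ∃ N S : C, star N = N ∧ N = star S * S ∧ N * G * N = - (star (S * N) * (S * N)) ∧
      (N = 0 → ∃ R : C, G = star R * R) := by
  let _ : PartialOrder C := CStarAlgebra.spectralOrder C
  have : StarOrderedRing C := CStarAlgebra.spectralOrderedRing C
  have hN0 : 0 ≤ G⁻ := CFC.negPart_nonneg G
  have hNs : star G⁻ = G⁻ := (IsSelfAdjoint.of_nonneg hN0).star_eq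
  obtain ⟨S, hS⟩ := CStarAlgebra.nonneg_iff_eq_star_mul_self.mp hN0
  refine ⟨G⁻, S, hNs, hS, ?_, fun h => ?_⟩
  · have hGN : G * G⁻ = - (G⁻ * G⁻) := by
      have := congrArg (· * G⁻) (CFC.posPart_sub_negPart G hG)
      simp only [sub_mul, CFC.posPart_mul_negPart, zero_sub] at this
      exact this.symm
    rw [mul_assoc, hGN, mul_neg, star_mul, hNs, mul_assoc, ← mul_assoc (star S), ← hS]
  · exact CStarAlgebra.nonneg_iff_eq_star_mul_self.mp ((CFC.negPart_eq_zero_iff G hG).mp h)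

/-- A self-adjoint matrix `G` over `A` with `∑ i j, star (c i) * G i j * c j ≥ 0` for all `c` is
of the form `star R * R`. -/
theorem exists_gram {n : Type*} [Fintype n] [StarOrderedRing A] (G : CStarMatrix n n A)
    (hG : IsSelfAdjoint G) (h : ∀ c : n → A, 0 ≤ ∑ i, ∑ j, star (c i) * G i j * c j) :
    ∃ R : CStarMatrix n n A, G = star R * R := by
  classical
  obtain ⟨N, S, hNs, hS, h1, hfin⟩ := exists_neg_part G hG
  have hdiag : ∀ k i, (S * N) i k = 0 := by
    intro k
    have e1 : (N * G * N) k k = ∑ i, ∑ j, star (N i k) * G i j * N j k := by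
      simp only [CStarMatrix.mul_apply, Finset.sum_mul]
      rw [Finset.sum_comm]
      refine Finset.sum_congr rfl fun i _ => Finset.sum_congr rfl fun j _ => ?_
      rw [← CStarMatrix.star_apply, hNs]
    have e2 : (star (S * N) * (S * N)) k k = ∑ i, star ((S * N) i k) * (S * N) i k := by
      rw [CStarMatrix.mul_apply]
      rfl
    have e3 : 0 ≤ - ∑ i, star ((S * N) i k) * (S * N) i k := by
      rw [← e2]
      have : (-(star (S * N) * (S * N))) k k = -((star (S * N) * (S * N)) k k) := rfl
      rw [← this, ← h1, e1]
      exact h fun i => N i k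
    have e4 : ∀ i ∈ Finset.univ, 0 ≤ star ((S * N) i k) * (S * N) i k :=
      fun i _ => star_mul_self_nonneg _
    have e5 : ∑ i, star ((S * N) i k) * (S * N) i k = 0 :=
      le_antisymm (neg_nonneg.mp e3) (Finset.sum_nonneg e4)
    intro i
    have := (Finset.sum_eq_zero_iff_of_nonneg e4).mp e5 i (Finset.mem_univ i)
    exact CStarRing.star_mul_self_eq_zero_iff _ |>.mp this
  have hSN : S * N = 0 := CStarMatrix.ext fun i k => hdiag k i
  have hNN : star N * N = 0 := by
    have : N * N = star S * (S * N) := by rw [← mul_assoc, ← hS]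
    rw [hNs, this, hSN, mul_zero]
  exact hfin ((CStarRing.star_mul_self_eq_zero_iff _).mp hNN)

variable [StarOrderedRing A] [PartialOrder B] [StarOrderedRing B]

theorem form_self_nonneg (z : AlgExtension φ H) : 0 ≤ form φ H z z := by
  classical
  obtain ⟨s, hs⟩ := TensorProduct.exists_finset (R := ℂ) (M := H) (N := B) z
  let n := {p // p ∈ s}
  let G : CStarMatrix n n A := fun i j => inner A i.1.1 j.1.1
  have hG : IsSelfAdjoint G := CStarMatrix.ext fun i j => PreHilbertModule.star_inner _ _
  obtain ⟨R, hR⟩ := exists_gram G hG (by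
    intro c
    have : ∑ i, ∑ j, star (c i) * G i j * c j
        = inner A (∑ i : n, i.1.1 <• c i) (∑ i : n, i.1.1 <• c i) := by
      rw [← PreHilbertModule.innerₛₗ_apply]
      simp only [map_sum, LinearMap.sum_apply, PreHilbertModule.innerₛₗ_apply,
        PreHilbertModule.inner_act_right, PreHilbertModule.inner_act_left]
      rw [Finset.sum_comm]
    rw [this]
    exact PreHilbertModule.inner_self_nonneg _)
  have hz : z = ∑ i : n, tmul φ i.1.1 i.1.2 := by
    rw [hs]
    exact (Finset.sum_attach s (fun p => tmul φ p.1 p.2)).symm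
  have hform : form φ H z z
      = ∑ k : n, star (∑ i : n, φ (R k i) * i.1.2) * (∑ j : n, φ (R k j) * j.1.2) := by
    rw [hz]
    simp only [map_sum, LinearMap.sum_apply, form_tmul, star_sum, Finset.sum_mul, Finset.mul_sum]
    have hin : ∀ i j : n, inner A i.1.1 j.1.1 = ∑ k : n, star (R k i) * R k j := by
      intro i j
      have : G i j = (star R * R) i j := by rw [← hR]
      rw [CStarMatrix.mul_apply] at this
      exact this
    simp only [hin, map_sum, map_mul, map_star, Finset.mul_sum, Finset.sum_mul, star_mul]
    rw [Finset.sum_comm (s := (Finset.univ : Finset n)) (t := Finset.univ)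
      (f := fun k j => ∑ i, star i.1.2 * star (φ (R k i)) * (φ (R k j) * j.1.2))]
    refine Finset.sum_congr rfl fun j _ => ?_
    rw [Finset.sum_comm]
    refine Finset.sum_congr rfl fun k _ => Finset.sum_congr rfl fun i _ => ?_
    simp only [mul_assoc]
  rw [hform]
  exact Finset.sum_nonneg fun k _ => star_mul_self_nonneg _

theorem norm_form_sq_le (z w : AlgExtension φ H) :
    ‖form φ H z w‖ ^ 2 ≤ ‖form φ H z z‖ * ‖form φ H w w‖ := by
  refine norm_le_of_star_mul_self_le (form_self_nonneg φ z) (form_self_nonneg φ w) fun s => ?_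
  have h := form_self_nonneg φ (w - (s : ℂ) • act φ (form φ H z w) z)
  have e : form φ H (w - (s : ℂ) • act φ (form φ H z w) z)
      (w - (s : ℂ) • act φ (form φ H z w) z)
      = form φ H w w - (2 * s) • (star (form φ H z w) * form φ H z w)
        + s ^ 2 • (star (form φ H z w) * form φ H z z * form φ H z w) := by
    simp only [map_sub, LinearMap.sub_apply, map_smul, LinearMap.map_smulₛₗ, LinearMap.smul_apply,
      form_act_right, form_act_left, Complex.conj_ofReal, star_form]
    simp only [Complex.coe_smul]
    module
  rwa [e] at h

noncomputable instance : Norm (AlgExtension φ H) where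
  norm z := √‖form φ H z z‖

theorem norm_def (z : AlgExtension φ H) : ‖z‖ = √‖form φ H z z‖ := rfl

theorem norm_sq_eq (z : AlgExtension φ H) : ‖z‖ ^ 2 = ‖form φ H z z‖ :=
  Real.sq_sqrt (norm_nonneg _)

theorem norm_form_le (z w : AlgExtension φ H) : ‖form φ H z w‖ ≤ ‖z‖ * ‖w‖ := by
  rw [norm_def, norm_def, ← Real.sqrt_mul (norm_nonneg _)]
  exact Real.le_sqrt_of_sq_le (norm_form_sq_le φ z w)

theorem core : SeminormedSpace.Core ℂ (AlgExtension φ H) where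
  norm_nonneg z := Real.sqrt_nonneg _
  norm_smul c z := by
    simp only [norm_def, map_smul, LinearMap.map_smulₛₗ, LinearMap.smul_apply, norm_smul,
      RCLike.norm_conj]
    rw [← mul_assoc, Real.sqrt_mul (by positivity), Real.sqrt_mul_self (norm_nonneg _)]
  norm_triangle z w := by
    have hz : (0 : ℝ) ≤ ‖z‖ := Real.sqrt_nonneg _
    have hw : (0 : ℝ) ≤ ‖w‖ := Real.sqrt_nonneg _
    refine le_of_sq_le_sq ?_ (by positivity)
    rw [norm_sq_eq]
    calc ‖form φ H (z + w) (z + w)‖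
        = ‖form φ H z z + form φ H w z + (form φ H z w + form φ H w w)‖ := by
          simp only [map_add, LinearMap.add_apply]
      _ ≤ ‖form φ H z z‖ + ‖form φ H w z‖ + (‖form φ H z w‖ + ‖form φ H w w‖) :=
          (norm_add_le _ _).trans (add_le_add (norm_add_le _ _) (norm_add_le _ _))
      _ ≤ ‖z‖ ^ 2 + ‖w‖ * ‖z‖ + (‖z‖ * ‖w‖ + ‖w‖ ^ 2) := by
          rw [norm_sq_eq, norm_sq_eq]
          gcongr
          · exact norm_form_le φ w z
          · exact norm_form_le φ z w
      _ = (‖z‖ + ‖w‖) ^ 2 := by ring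

noncomputable instance : SeminormedAddCommGroup (AlgExtension φ H) :=
  SeminormedAddCommGroup.ofCore (core φ)

noncomputable instance : NormedSpace ℂ (AlgExtension φ H) where
  norm_smul_le c z := ((core φ).norm_smul c z).le

theorem norm_act_le (b : B) (z : AlgExtension φ H) : ‖act φ b z‖ ≤ ‖b‖ * ‖z‖ := by
  refine le_of_sq_le_sq ?_ (by positivity)
  rw [norm_sq_eq, form_act_right, form_act_left, mul_pow, norm_sq_eq]
  calc ‖star b * form φ H z z * b‖ ≤ ‖star b‖ * ‖form φ H z z‖ * ‖b‖ :=
        (norm_mul_le _ _).trans (mul_le_mul_of_nonneg_right (norm_mul_le _ _) (norm_nonneg _))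
    _ = ‖b‖ ^ 2 * ‖form φ H z z‖ := by rw [norm_star]; ring

noncomputable instance : SMul Bᵐᵒᵖ (AlgExtension φ H) where
  smul b z := act φ b.unop z

theorem act_def (b : B) (z : AlgExtension φ H) : z <• b = act φ b z := rfl

instance : UniformContinuousConstSMul Bᵐᵒᵖ (AlgExtension φ H) where
  uniformContinuous_const_smul b := by
    have h := ((act φ b.unop : AlgExtension φ H →ₗ[ℂ] AlgExtension φ H).mkContinuous ‖b.unop‖
      (norm_act_le φ b.unop)).uniformContinuous
    exact h

variable (H) in
/-- The semi-inner product on `H ⊗ B` as a continuous sesquilinear map. -/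
noncomputable def formSL : AlgExtension φ H →L⋆[ℂ] AlgExtension φ H →L[ℂ] B :=
  LinearMap.mkContinuous₂ (form φ H) 1 fun z w => by simpa using norm_form_le φ z w

@[simp] theorem formSL_apply (z w : AlgExtension φ H) : formSL φ H z w = form φ H z w := rfl

end Positivity

end AlgExtension

section Completion

variable [StarOrderedRing A] [PartialOrder B] [StarOrderedRing B]

/-- The Hilbert `B`-module `H • B`: the completion of `(H ⊗ B) / N`, where `N` is the set of all
`z` with `⟨z, z⟩ = 0`.  (The completion of a seminormed space is Hausdorff, so the quotient by `N`
is taken at the same time.) -/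
abbrev HilbertExtension : Type _ := Completion (AlgExtension φ H)

namespace HilbertExtension

/-- The inner product on `H • B` as a continuous sesquilinear map. -/
noncomputable def innerSL : HilbertExtension φ H →L⋆[ℂ] HilbertExtension φ H →L[ℂ] B :=
  (AlgExtension.formSL φ H).fromCompletion.flip.fromCompletion.flip

noncomputable instance : Inner B (HilbertExtension φ H) where
  inner x y := innerSL φ H x y

variable {H}

theorem inner_def (x y : HilbertExtension φ H) : inner B x y = innerSL φ H x y := rfl

@[simp] theorem inner_coe (z w : AlgExtension φ H) :
    inner B (z : HilbertExtension φ H) (w : HilbertExtension φ H) = AlgExtension.form φ H z w := by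
  simp [inner_def, innerSL]

theorem continuous_inner {X : Type*} [TopologicalSpace X]
    {f g : X → HilbertExtension φ H} (hf : Continuous f) (hg : Continuous g) :
    Continuous fun t => inner B (f t) (g t) := by
  simp only [inner_def]
  exact ((innerSL φ H).continuous.comp hf).clm_apply hg

theorem norm_sq_eq (x : HilbertExtension φ H) : ‖x‖ ^ 2 = ‖(inner B x x : B)‖ := by
  refine Completion.induction_on x (isClosed_eq (continuous_norm.pow 2)
    (continuous_inner φ continuous_id continuous_id).norm) fun z => ?_
  rw [Completion.norm_coe, AlgExtension.norm_sq_eq, inner_coe]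

theorem coe_act (z : AlgExtension φ H) (b : B) :
    ((AlgExtension.act φ b z : AlgExtension φ H) : HilbertExtension φ H)
      = (z : HilbertExtension φ H) <• b :=
  Completion.coe_smul (MulOpposite.op b) z

theorem continuous_act (b : B) : Continuous fun x : HilbertExtension φ H => x <• b :=
  continuous_const_smul (MulOpposite.op b)

noncomputable instance : PreHilbertModule B (HilbertExtension φ H) where
  add_act x y a := by
    refine Completion.induction_on₂ x y (isClosed_eq
      ((continuous_act φ a).comp (continuous_fst.add continuous_snd))
      (((continuous_act φ a).comp continuous_fst).add
        ((continuous_act φ a).comp continuous_snd))) fun z w => ?_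
    rw [← Completion.coe_add, ← coe_act, map_add, Completion.coe_add, coe_act, coe_act]
  act_add x a b := by
    refine Completion.induction_on x (isClosed_eq
      (continuous_act φ (a + b))
      ((continuous_act φ a).add (continuous_act φ b))) fun z => ?_
    rw [← coe_act, AlgExtension.act_add, Completion.coe_add, coe_act, coe_act]
  act_mul x a b := by
    refine Completion.induction_on x (isClosed_eq
      (continuous_act φ (a * b))
      ((continuous_act φ b).comp (continuous_act φ a))) fun z => ?_
    rw [← coe_act, AlgExtension.act_mul, coe_act, coe_act]
  smul_act c x a := by
    refine Completion.induction_on x (isClosed_eq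
      ((continuous_act φ a).comp (continuous_const_smul c))
      ((continuous_act φ a).const_smul c)) fun z => ?_
    rw [← Completion.coe_smul, ← coe_act, map_smul, Completion.coe_smul, coe_act]
  act_smul c x a := by
    refine Completion.induction_on x (isClosed_eq
      (continuous_act φ (c • a))
      ((continuous_act φ a).const_smul c)) fun z => ?_
    rw [← coe_act, AlgExtension.act_smul, Completion.coe_smul, coe_act]
  inner_add_right x y z := by simp only [inner_def, map_add]
  inner_smul_right c x y := by simp only [inner_def, map_smul]
  inner_act_right x y a := by
    refine Completion.induction_on₂ x y (isClosed_eq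
      (continuous_inner φ continuous_fst ((continuous_act φ a).comp continuous_snd))
      ((continuous_inner φ continuous_fst continuous_snd).mul continuous_const)) fun z w => ?_
    rw [← coe_act, inner_coe, inner_coe, AlgExtension.form_act_right]
  star_inner x y := by
    refine Completion.induction_on₂ x y (isClosed_eq
      (continuous_inner φ continuous_fst continuous_snd).star
      (continuous_inner φ continuous_snd continuous_fst)) fun z w => ?_
    rw [inner_coe, inner_coe, AlgExtension.star_form]
  inner_self_nonneg x := by
    refine Completion.induction_on x (isClosed_le continuous_const
      (continuous_inner φ continuous_id continuous_id)) fun z => ?_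
    rw [inner_coe]
    exact AlgExtension.form_self_nonneg φ z
  eq_zero_of_inner_self x h := by
    have := norm_sq_eq φ x
    rw [h, norm_zero] at this
    exact norm_eq_zero.mp (pow_eq_zero_iff two_ne_zero |>.mp this)
  norm_sq_eq x := norm_sq_eq φ x

end HilbertExtension

end Completion

end Extension


section UnitalExtension

variable {A B : Type*} [NonUnitalCStarAlgebra A] [PartialOrder A] [StarOrderedRing A]
  [CStarAlgebra B] [PartialOrder B] [StarOrderedRing B] (φ : A →⋆ₙₐ[ℂ] B)
  (H : Type*) [NormedAddCommGroup H] [NormedSpace ℂ H] [SMul Aᵐᵒᵖ H] [PreHilbertModule A H]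

/-- The canonical map `H → H • B`, `x ↦ x ⊗ 1`, for a unital C⋆-algebra `B`. -/
noncomputable def HilbertExtension.ofModule : H →ₗ[ℂ] HilbertExtension φ H where
  toFun x := ((AlgExtension.tmul φ x 1 : AlgExtension φ H) : HilbertExtension φ H)
  map_add' x y := by
    rw [← Completion.coe_add]
    exact congrArg _ (TensorProduct.add_tmul x y (1 : B))
  map_smul' c x := by
    rw [RingHom.id_apply, ← Completion.coe_smul]
    exact congrArg _ (TensorProduct.smul_tmul' c x (1 : B)).symm

end UnitalExtension

/-! ## The bidual of a C⋆-algebra -/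

section Bidual

variable (A : Type*) [NonUnitalCStarAlgebra A] [PartialOrder A] [StarOrderedRing A]

/-- The states of `A`: the positive linear functionals of norm one. -/
def CStarState : Type _ := 
  {f : A →ₚ[ℂ] ℂ // ‖(⟨f.toLinearMap, map_continuous f⟩ : A →L[ℂ] ℂ)‖ = 1}

/-- The Hilbert space of the universal representation: the Hilbert space direct sum of the GNS
spaces of all states of `A`. -/
abbrev UniversalSpace : Type _ := lp (fun f : CStarState A => f.1.GNS) 2

/-- The universal representation of `A`: the direct sum of the GNS representations of all
states. -/
noncomputable def universalRep : A →⋆ₙₐ[ℂ] (UniversalSpace A →L[ℂ] UniversalSpace A) where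
  toFun a := lp.mapCLM 2 (fun f : CStarState A => f.1.gnsNonUnitalStarAlgHom a) (norm_nonneg a)
    (fun f => NonUnitalStarAlgHom.norm_apply_le f.1.gnsNonUnitalStarAlgHom a)
  map_smul' c a := by ext; simp
  map_zero' := by ext; simp
  map_add' a b := by ext; simp
  map_mul' a b := by ext; simp
  map_star' a := by
    rw [ContinuousLinearMap.star_eq_adjoint, ContinuousLinearMap.eq_adjoint_iff]
    intro x y
    rw [lp.inner_eq_tsum, lp.inner_eq_tsum]
    refine tsum_congr fun f => ?_
    simp [map_star, ContinuousLinearMap.star_eq_adjoint, ContinuousLinearMap.adjoint_inner_left]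

/-- The double commutant of the image of `A` under its universal representation. -/
noncomputable def bidualSubalgebra :
    StarSubalgebra ℂ (UniversalSpace A →L[ℂ] UniversalSpace A) :=
  StarSubalgebra.centralizer ℂ
    (StarSubalgebra.centralizer ℂ (Set.range (universalRep A)) :
      Set (UniversalSpace A →L[ℂ] UniversalSpace A))

theorem mem_bidualSubalgebra_iff (x : UniversalSpace A →L[ℂ] UniversalSpace A) :
    x ∈ bidualSubalgebra A ↔ ∀ T : UniversalSpace A →L[ℂ] UniversalSpace A,
      (∀ a, universalRep A a * T = T * universalRep A a) → T * x = x * T := by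
  have h : (bidualSubalgebra A : Set (UniversalSpace A →L[ℂ] UniversalSpace A))
      = (Set.range (universalRep A)).centralizer.centralizer := by
    have hs : star (Set.range (universalRep A)) = Set.range (universalRep A) := by
      ext y
      refine ⟨fun ⟨a, ha⟩ => ⟨star a, by rw [map_star, ha, star_star]⟩,
        fun ⟨a, ha⟩ => ⟨star a, by rw [map_star, ha]⟩⟩
    rw [bidualSubalgebra, StarSubalgebra.coe_centralizer_centralizer, hs, Set.union_self]
  rw [← SetLike.mem_coe, h]
  simp only [Set.mem_centralizer_iff, Set.forall_mem_range]

instance : IsClosed (bidualSubalgebra A : Set (UniversalSpace A →L[ℂ] UniversalSpace A)) :=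
  Set.isClosed_centralizer _

/-- The enveloping von Neumann algebra `A**` of `A`. -/
def Bidual : Type _ := ↥(bidualSubalgebra A)

noncomputable instance : CStarAlgebra (Bidual A) :=
  inferInstanceAs (CStarAlgebra ↥(bidualSubalgebra A))

noncomputable instance : PartialOrder (Bidual A) := CStarAlgebra.spectralOrder _

instance : StarOrderedRing (Bidual A) := CStarAlgebra.spectralOrderedRing _

/-- The canonical embedding of `A` in `A**`. -/
noncomputable def toBidual : A →⋆ₙₐ[ℂ] Bidual A where
  toFun a := ⟨universalRep A a, (mem_bidualSubalgebra_iff A _).mpr fun T hT => (hT a).symm⟩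
  map_smul' c a := Subtype.ext (map_smul (universalRep A) c a)
  map_zero' := Subtype.ext (map_zero (universalRep A))
  map_add' a b := Subtype.ext (map_add (universalRep A) a b)
  map_mul' a b := Subtype.ext (map_mul (universalRep A) a b)
  map_star' a := Subtype.ext (map_star (universalRep A) a)

variable (H : Type*) [NormedAddCommGroup H] [NormedSpace ℂ H] [SMul Aᵐᵒᵖ H] [PreHilbertModule A H]

/-- The Hilbert `A**`-module `H • A**`. -/
abbrev BidualExtension : Type _ := HilbertExtension (toBidual A) H

/-- The dual module `H^∼ = (H • A**)^♯`. -/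
abbrev HSim : Type _ := SharpDual (Bidual A) (BidualExtension A H)

/-- The canonical map `H → H • A** → (H • A**)^♯ = H^∼`. -/
noncomputable def toHSim : H →ₗ[ℂ] HSim A H :=
  PreHilbertModule.toSharpDual (Bidual A) (BidualExtension A H) ∘ₗ
    HilbertExtension.ofModule (toBidual A) H

end Bidual

universe u v w

/-!
A bounded module map `f : E → M` into a von Neumann algebra `M` acting on a Hilbert space `K` is the
same thing as an operator.  On the interior tensor product `E ⊗_M K`, the Hilbert space with
`⟨x ⊗ ξ, y ⊗ η⟩ = ⟨ξ, ⟨x, y⟩ η⟩`, let `S_f (x ⊗ ξ) = f(x) ξ`.  Paschke's inequality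
`f(x)⋆ f(x) ≤ ‖f‖² ⟨x, x⟩`, used for matrices, says that `S_f` is bounded, with `‖S_f‖ = ‖f‖`.  The
operator `S_f S_g⋆` commutes with the commutant of `M`, because `S_f (1 ⊗ t) = t S_f` for every `t`
in that commutant; hence it lies in `M`, and `⟨f, g⟩ = S_f S_g⋆` is an inner product on `E^♯`
(`SharpDual.preHilbertModule`).  Since `S_x⋆ ξ = x ⊗ ξ` for `x` in `E`, it satisfies `⟨f, x⟩ = f(x)`.

For self-duality (`SharpDual.isSelfDual_sharpDual`) let `F : E^♯ → M` be a bounded module map and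
let `f` be its restriction to `E`.  Then `F - ⟨f, ·⟩` vanishes on `E`, and such a map is zero: the
isometry `g ⊗ ξ ↦ S_g⋆ ξ` from `E^♯ ⊗_M K` to `E ⊗_M K` shows that `E ⊗_M K` is dense in
`E^♯ ⊗_M K`, so that the operator `S` of the difference is zero.

The universal property is then formal.  An embedding `ι` of `H` in a self-dual module `H₁` extends
to an embedding `i` of `E = H • M`, and the map `r : H₁ → E^♯`, `r(y) = ⟨y, i ·⟩`, has an adjoint
`j`, because `H₁` is self-dual.  From `⟨r(j f), x⟩ = ⟨f, r(i x)⟩ = f(x)` it follows that `r j = 1`,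
so `j` preserves inner products.  Uniqueness and the decomposition of `H₁` follow from the
self-duality of `E^♯`, by representing the maps `g ↦ ⟨y, j g⟩`.
-/

/-! ### Bounded module maps and Paschke's inequality -/

/-- A C⋆-algebraic Douglas-type lemma: a norm estimate for all conjugates of `p` and `q` by the
same element gives an operator inequality.  It is enough to test on `a = (c (q + ε))^(-1/2)`. -/
theorem star_mul_self_le_of_norm_mul_sq_le {M : Type*} [CStarAlgebra M] [PartialOrder M]
    [StarOrderedRing M] {p q : M} {c : ℝ} (hc0 : 0 ≤ c) (hq : 0 ≤ q)
    (h : ∀ a : M, ‖p * a‖ ^ 2 ≤ c * ‖star a * q * a‖) :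
    star p * p ≤ c • q := by
  -- `d` replaces `c`, which may be zero, so that `b` below is invertible.
  have key : ∀ ε : ℝ, 0 < ε → ∀ d : ℝ, c ≤ d → 0 < d →
      star p * p ≤ d • (q + algebraMap ℝ M ε) := by
    intro ε hε d hcd hd
    set b : M := d • (q + algebraMap ℝ M ε) with hb
    have hbpos : IsStrictlyPositive b := by
      have h1 : IsStrictlyPositive (q + algebraMap ℝ M ε) :=
        IsStrictlyPositive.nonneg_add hq (by cfc_tac)
      exact h1.smul hd
    -- Testing on `s = b^(-1/2)` gives `s p⋆ p s ≤ 1`; conjugation by `b s = b^(1/2)` gives the claim.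
    obtain ⟨s, hs, hsb, hcomm⟩ : ∃ s : M, star s = s ∧ s * b * s = 1 ∧ s * b = b * s := by
      refine ⟨b ^ (-(1 / 2) : ℝ), ?_, CFC.conjugate_rpow_neg_one_half b, ?_⟩
      · exact (IsSelfAdjoint.of_nonneg CFC.rpow_nonneg).star_eq
      · have hz : IsUnit b := hbpos.isUnit
        have h1 : b ^ (-(1 / 2) : ℝ) * b ^ (1 : ℝ) = b ^ (1 : ℝ) * b ^ (-(1 / 2) : ℝ) := by
          rw [← CFC.rpow_add hz, ← CFC.rpow_add hz, add_comm]
        rwa [CFC.rpow_one b hbpos.nonneg] at h1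
    have hps : ‖p * s‖ ^ 2 ≤ 1 := by
      refine (h s).trans ?_
      rw [hs]
      have h1 : d • (s * q * s) ≤ 1 := by
        rw [← hsb, hb]
        have : s * (d • (q + algebraMap ℝ M ε)) * s
            = d • (s * q * s) + (d * ε) • (star s * s) := by
          simp only [Algebra.algebraMap_eq_smul_one, mul_smul_comm, smul_mul_assoc, mul_add,
            add_mul, smul_add, smul_smul, mul_one, hs]
        rw [this]
        exact le_add_of_nonneg_right (smul_nonneg (by positivity) (star_mul_self_nonneg s))
      have h0 : 0 ≤ s * q * s := by
        have := star_left_conjugate_nonneg hq s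
        rwa [hs] at this
      have h2 : ‖d • (s * q * s)‖ ≤ 1 := by
        refine (CStarAlgebra.norm_le_norm_of_nonneg_of_le (smul_nonneg hd.le h0) h1).trans ?_
        nontriviality M
        exact CStarRing.norm_one.le
      rw [norm_smul, Real.norm_of_nonneg hd.le] at h2
      exact (mul_le_mul_of_nonneg_right hcd (norm_nonneg _)).trans h2
    have h3 : star (p * s) * (p * s) ≤ 1 := by
      have h4 := IsSelfAdjoint.le_algebraMap_norm_self (a := star (p * s) * (p * s))
        (IsSelfAdjoint.star_mul_self _)
      rw [CStarRing.norm_star_mul_self, ← sq] at h4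
      refine h4.trans ?_
      rw [← map_one (algebraMap ℝ M)]
      exact algebraMap_mono M hps
    have h5 := star_left_conjugate_le_conjugate h3 (b * s)
    have hsb' : s * (b * s) = 1 := by rw [← mul_assoc, hsb]
    have hbs : star (b * s) = s * b := by rw [star_mul, hs, hbpos.nonneg.star_eq]
    have e1 : star (b * s) * (star (p * s) * (p * s)) * (b * s) = star p * p := by
      have : b * s * s = 1 := by rw [← hcomm, hsb]
      rw [hbs, star_mul, hs, hcomm]
      calc b * s * (s * star p * (p * s)) * (b * s)
          = (b * s * s) * (star p * p) * (s * (b * s)) := by simp only [mul_assoc]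
        _ = star p * p := by rw [this, hsb', one_mul, mul_one]
    have e2 : star (b * s) * 1 * (b * s) = b := by
      rw [hbs, mul_one, hcomm, mul_assoc, ← mul_assoc s b s, hsb, mul_one]
    rwa [e1, e2] at h5
  have hc : ∀ d : ℝ, c < d → 0 < d → star p * p ≤ d • q := by
    intro d hcd hd
    have hlim : Filter.Tendsto (fun ε : ℝ => d • (q + algebraMap ℝ M ε))
        (nhdsWithin 0 (Set.Ioi 0)) (nhds (d • (q + algebraMap ℝ M 0))) := by
      have hcont : Continuous fun ε : ℝ => d • (q + algebraMap ℝ M ε) :=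
        (continuous_const.add (continuous_algebraMap ℝ M)).const_smul d
      exact (hcont.tendsto 0).mono_left nhdsWithin_le_nhds
    rw [map_zero, add_zero] at hlim
    exact ge_of_tendsto hlim (Filter.eventually_of_mem self_mem_nhdsWithin
      fun ε hε => key ε hε d hcd.le hd)
  have hlim : Filter.Tendsto (fun d : ℝ => d • q) (nhdsWithin c (Set.Ioi c)) (nhds (c • q)) :=
    ((continuous_id.smul continuous_const).tendsto c).mono_left nhdsWithin_le_nhds
  exact ge_of_tendsto hlim (Filter.eventually_of_mem self_mem_nhdsWithin
    fun d hd => hc d hd (hc0.trans_lt hd))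

namespace SharpDual

variable {M E : Type*} [CStarAlgebra M] [PartialOrder M] [StarOrderedRing M]
  [NormedAddCommGroup E] [NormedSpace ℂ E] [SMul Mᵐᵒᵖ E] [PreHilbertModule M E]

theorem norm_apply_le (f : SharpDual M E) (x : E) : ‖f x‖ ≤ ‖f‖ * ‖x‖ :=
  f.1.le_opNorm x

/-- **Paschke's inequality** for a bounded module map. -/
theorem star_apply_mul_apply_le (f : SharpDual M E) (x : E) :
    star (f x) * f x ≤ ‖f‖ ^ 2 • inner M x x := by
  refine star_mul_self_le_of_norm_mul_sq_le (sq_nonneg _)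
    (PreHilbertModule.inner_self_nonneg x) fun a => ?_
  rw [← map_act]
  refine (pow_le_pow_left₀ (norm_nonneg _) (f.norm_apply_le _) 2).trans ?_
  rw [mul_pow, PreHilbertModule.norm_sq_eq (A := M) (x <• a), PreHilbertModule.inner_act_right,
    PreHilbertModule.inner_act_left]

end SharpDual

/-! ### The interior tensor product with a represented Hilbert space -/

section Gram

variable {M K : Type*} [CStarAlgebra M] [PartialOrder M] [StarOrderedRing M]
  [NormedAddCommGroup K] [InnerProductSpace ℂ K] [CompleteSpace K] (σ : M →⋆ₐ[ℂ] (K →L[ℂ] K))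

theorem ofReal_norm_sum_sq {n : Type*} [Fintype n] (v : n → K) :
    ((‖∑ i, v i‖ ^ 2 : ℝ) : ℂ) = ∑ i, ∑ j, ⟪v i, v j⟫_ℂ := by
  have h := inner_self_eq_norm_sq_to_K (𝕜 := ℂ) (∑ i, v i)
  rw [sum_inner] at h
  simp only [inner_sum] at h
  rw [h]
  norm_cast

/-- The quadratic form of a positive matrix over `M`, evaluated in a representation, is a sum of
squares: the matrix has a factorization `G = R⋆ R`. -/
theorem exists_sum_inner_eq_sum_norm_sq {n : Type*} [Fintype n] (G : n → n → M)
    (hstar : ∀ i j, star (G i j) = G j i)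
    (hpos : ∀ c : n → M, 0 ≤ ∑ i, ∑ j, star (c i) * G i j * c j) :
    ∃ R : n → n → M, ∀ ξ : n → K,
      ∑ i, ∑ j, ⟪ξ i, σ (G i j) (ξ j)⟫_ℂ = ((∑ k, ‖∑ j, σ (R k j) (ξ j)‖ ^ 2 : ℝ) : ℂ) := by
  classical
  let G' : CStarMatrix n n M := fun i j => G i j
  have hG' : IsSelfAdjoint G' := CStarMatrix.ext fun i j => hstar j i
  obtain ⟨R, hR⟩ := AlgExtension.exists_gram G' hG' hpos
  refine ⟨fun k j => R k j, fun ξ => ?_⟩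
  have hG : ∀ i j, G i j = ∑ k, star (R k i) * R k j := by
    intro i j
    have : G' i j = (star R * R) i j := by rw [← hR]
    rwa [CStarMatrix.mul_apply] at this
  have e : ∀ i j, ⟪ξ i, σ (G i j) (ξ j)⟫_ℂ = ∑ k, ⟪σ (R k i) (ξ i), σ (R k j) (ξ j)⟫_ℂ := by
    intro i j
    rw [hG, map_sum, sum_apply, inner_sum]
    refine Finset.sum_congr rfl fun k _ => ?_
    rw [map_mul, map_star, mul_apply_eq_comp, ContinuousLinearMap.star_eq_adjoint,
      ContinuousLinearMap.adjoint_inner_right]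
  simp only [e]
  push_cast
  simp only [← Complex.ofReal_pow, ofReal_norm_sum_sq]
  rw [Finset.sum_comm]
  exact (Finset.sum_congr rfl fun i _ => Finset.sum_comm).symm.trans
    (Finset.sum_comm.trans (Finset.sum_congr rfl fun k _ => Finset.sum_comm))

end Gram

/-- The algebraic tensor product `E ⊗ K` of a pre-Hilbert `M`-module and a Hilbert space `K` on
which `M` acts through `σ`, with the semi-inner product determined by
`⟨x ⊗ ξ, y ⊗ η⟩ = ⟨ξ, σ ⟨x, y⟩ η⟩`. -/
@[nolint unusedArguments]
def InteriorTensor {M K : Type*} [CStarAlgebra M]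
    [NormedAddCommGroup K] [InnerProductSpace ℂ K] [CompleteSpace K]
    (_σ : M →⋆ₐ[ℂ] (K →L[ℂ] K)) (E : Type*) [NormedAddCommGroup E] [NormedSpace ℂ E] :
    Type _ := E ⊗[ℂ] K

namespace InteriorTensor

variable {M K : Type*} [CStarAlgebra M] [PartialOrder M] [StarOrderedRing M]
  [NormedAddCommGroup K] [InnerProductSpace ℂ K] [CompleteSpace K] (σ : M →⋆ₐ[ℂ] (K →L[ℂ] K))
  (E : Type*) [NormedAddCommGroup E] [NormedSpace ℂ E] [SMul Mᵐᵒᵖ E] [PreHilbertModule M E]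

noncomputable instance : AddCommGroup (InteriorTensor σ E) :=
  inferInstanceAs (AddCommGroup (E ⊗[ℂ] K))
noncomputable instance : Module ℂ (InteriorTensor σ E) :=
  inferInstanceAs (Module ℂ (E ⊗[ℂ] K))

variable {E} in
/-- The elementary tensor `x ⊗ ξ`. -/
def tmul (x : E) (ξ : K) : InteriorTensor σ E := x ⊗ₜ[ℂ] ξ

/-- For fixed `x` and `ξ` the linear map `y ⊗ η ↦ ⟨ξ, σ ⟨x, y⟩ η⟩`. -/
noncomputable def formAux : E →ₗ⋆[ℂ] K →ₗ⋆[ℂ] (E ⊗[ℂ] K →ₗ[ℂ] ℂ) :=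
  LinearMap.mk₂'ₛₗ (starRingEnd ℂ) (starRingEnd ℂ)
    (fun x ξ => TensorProduct.lift (LinearMap.mk₂ ℂ
      (fun y η => ⟪ξ, σ (inner M x y) η⟫_ℂ)
      (by intros; simp [PreHilbertModule.inner_add_right])
      (by intros; simp [PreHilbertModule.inner_smul_right])
      (by intros; simp)
      (by intros; simp)))
    (by intros; ext; simp [PreHilbertModule.inner_add_left])
    (by intros; ext; simp [PreHilbertModule.inner_smul_left])
    (by intros; ext; simp)
    (by intros; ext; simp [mul_comm])

/-- The semi-inner product on `E ⊗ K`. -/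
noncomputable def form : InteriorTensor σ E →ₗ⋆[ℂ] InteriorTensor σ E →ₗ[ℂ] ℂ :=
  TensorProduct.lift (formAux σ E)

variable {E}

@[simp] theorem form_tmul (x y : E) (ξ η : K) :
    form σ E (tmul σ x ξ) (tmul σ y η) = ⟪ξ, σ (inner M x y) η⟫_ℂ := rfl

@[elab_as_elim]
theorem induction {P : InteriorTensor σ E → Prop} (z : InteriorTensor σ E) (h0 : P 0)
    (ht : ∀ x ξ, P (tmul σ x ξ)) (ha : ∀ x y, P x → P y → P (x + y)) : P z :=
  TensorProduct.induction_on z h0 ht ha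

theorem conj_form (z w : InteriorTensor σ E) :
    starRingEnd ℂ (form σ E z w) = form σ E w z := by
  induction z using induction with
  | h0 => simp
  | ha x y hx hy => simp [hx, hy]
  | ht x ξ =>
    induction w using induction with
    | h0 => simp
    | ha x y hx hy => simp [hx, hy]
    | ht y η =>
      rw [form_tmul, form_tmul, inner_conj_symm, ← PreHilbertModule.star_inner y x, map_star,
        ContinuousLinearMap.star_eq_adjoint, ContinuousLinearMap.adjoint_inner_left]

theorem exists_eq_sum_tmul (z : InteriorTensor σ E) :
    ∃ (n : ℕ) (x : Fin n → E) (ξ : Fin n → K), z = ∑ i, tmul σ (x i) (ξ i) := by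
  induction z using induction with
  | h0 => exact ⟨0, 0, 0, by simp⟩
  | ht x ξ => exact ⟨1, fun _ => x, fun _ => ξ, by simp⟩
  | ha z w hz hw =>
    obtain ⟨n, x, ξ, rfl⟩ := hz
    obtain ⟨m, y, η, rfl⟩ := hw
    exact ⟨n + m, Fin.append x y, Fin.append ξ η, by simp [Fin.sum_univ_add]⟩

theorem form_sum_tmul {n : ℕ} (x : Fin n → E) (ξ : Fin n → K) :
    form σ E (∑ i, tmul σ (x i) (ξ i)) (∑ i, tmul σ (x i) (ξ i))
      = ∑ i, ∑ j, ⟪ξ i, σ (inner M (x i) (x j)) (ξ j)⟫_ℂ := by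
  simp only [map_sum, LinearMap.sum_apply, form_tmul]
  exact Finset.sum_comm

theorem sum_star_mul_inner_mul {n : Type*} [Fintype n] (x : n → E) (c : n → M) :
    ∑ i, ∑ j, star (c i) * inner M (x i) (x j) * c j
      = inner M (∑ i, x i <• c i) (∑ i, x i <• c i) := by
  rw [← PreHilbertModule.innerₛₗ_apply]
  simp only [map_sum, LinearMap.sum_apply, PreHilbertModule.innerₛₗ_apply,
    PreHilbertModule.inner_act_right, PreHilbertModule.inner_act_left]
  rw [Finset.sum_comm]

/-- The factor `R` of the Gram matrix of `x` does not depend on the vectors of `K`; this is what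
bounds `1 ⊗ t` for `t` in the commutant. -/
theorem exists_form_eq_sum_norm_sq {n : ℕ} (x : Fin n → E) :
    ∃ R : Fin n → Fin n → M, ∀ ξ : Fin n → K,
      form σ E (∑ i, tmul σ (x i) (ξ i)) (∑ i, tmul σ (x i) (ξ i))
        = ((∑ k, ‖∑ j, σ (R k j) (ξ j)‖ ^ 2 : ℝ) : ℂ) := by
  simp only [form_sum_tmul]
  refine exists_sum_inner_eq_sum_norm_sq σ (fun i j => inner M (x i) (x j))
    (fun i j => PreHilbertModule.star_inner _ _) fun c => ?_
  rw [sum_star_mul_inner_mul]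
  exact PreHilbertModule.inner_self_nonneg _

theorem re_form_self_nonneg (z : InteriorTensor σ E) : 0 ≤ (form σ E z z).re := by
  obtain ⟨n, x, ξ, rfl⟩ := exists_eq_sum_tmul σ z
  obtain ⟨R, hR⟩ := exists_form_eq_sum_norm_sq σ x
  rw [hR, Complex.ofReal_re]
  positivity

/-- The semi-inner product on `E ⊗ K` as a `PreInnerProductSpace.Core`. -/
noncomputable abbrev core : PreInnerProductSpace.Core ℂ (InteriorTensor σ E) where
  inner z w := form σ E z w
  conj_inner_symm z w := conj_form σ w z
  re_inner_nonneg z := re_form_self_nonneg σ z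
  add_left z w v := by simp
  smul_left z w c := by simp

noncomputable instance : SeminormedAddCommGroup (InteriorTensor σ E) :=
  InnerProductSpace.Core.toSeminormedAddCommGroup (c := core σ)

noncomputable instance : InnerProductSpace ℂ (InteriorTensor σ E) :=
  InnerProductSpace.ofCore (core σ)

theorem inner_def (z w : InteriorTensor σ E) : ⟪z, w⟫_ℂ = form σ E z w := rfl

theorem inner_tmul (x y : E) (ξ η : K) :
    ⟪tmul σ x ξ, tmul σ y η⟫_ℂ = ⟪ξ, σ (inner M x y) η⟫_ℂ := rfl

theorem norm_sq_eq (z : InteriorTensor σ E) : ‖z‖ ^ 2 = (form σ E z z).re := by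
  rw [← inner_def, ← inner_self_eq_norm_sq (𝕜 := ℂ)]
  rfl

theorem norm_tmul_le (x : E) (ξ : K) : ‖tmul σ x ξ‖ ≤ ‖x‖ * ‖ξ‖ := by
  refine le_of_sq_le_sq ?_ (by positivity)
  rw [norm_sq_eq, form_tmul]
  calc (⟪ξ, σ (inner M x x) ξ⟫_ℂ).re ≤ ‖ξ‖ * ‖σ (inner M x x) ξ‖ := re_inner_le_norm (𝕜 := ℂ) _ _
    _ ≤ ‖ξ‖ * (‖(inner M x x : M)‖ * ‖ξ‖) := by
      gcongr
      exact ((σ _).le_opNorm ξ).trans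
        (mul_le_mul_of_nonneg_right (NonUnitalStarAlgHom.norm_apply_le σ _) (norm_nonneg _))
    _ = (‖x‖ * ‖ξ‖) ^ 2 := by rw [← PreHilbertModule.norm_sq_eq]; ring


/-- The matrix form of Paschke's inequality.  Testing the matrix
`‖f‖² ⟨x i, x j⟩ - f(x i)⋆ f(x j)` on a column `c` amounts to the scalar inequality at
`∑ x i c i`, so the matrix is positive. -/
theorem norm_sum_apply_sq_le (f : SharpDual M E) {n : ℕ} (x : Fin n → E) (ξ : Fin n → K) :
    ‖∑ i, σ (f (x i)) (ξ i)‖ ^ 2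
      ≤ ‖f‖ ^ 2 * (form σ E (∑ i, tmul σ (x i) (ξ i)) (∑ i, tmul σ (x i) (ξ i))).re := by
  obtain ⟨R, hR⟩ := exists_sum_inner_eq_sum_norm_sq σ
    (fun i j => ‖f‖ ^ 2 • inner M (x i) (x j) - star (f (x i)) * f (x j))
    (fun i j => by simp [PreHilbertModule.star_inner]) (fun c => by
      have h := sub_nonneg.mpr (f.star_apply_mul_apply_le (∑ i, x i <• c i))
      rw [← sum_star_mul_inner_mul] at h
      have e : f (∑ i, x i <• c i) = ∑ i, f (x i) * c i := by
        simp only [← f.map_act]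
        exact map_sum f.1 _ _
      rw [e, star_sum, Finset.sum_mul_sum, Finset.smul_sum] at h
      simp only [Finset.smul_sum, ← Finset.sum_sub_distrib] at h
      refine h.trans_eq (Finset.sum_congr rfl fun i _ => Finset.sum_congr rfl fun j _ => ?_)
      simp only [mul_sub, sub_mul, star_mul, mul_smul_comm, smul_mul_assoc, mul_assoc])
  have h := hR ξ
  have e : ∀ i j, ⟪ξ i, σ (‖f‖ ^ 2 • inner M (x i) (x j) - star (f (x i)) * f (x j)) (ξ j)⟫_ℂ
      = (‖f‖ ^ 2 : ℝ) * ⟪ξ i, σ (inner M (x i) (x j)) (ξ j)⟫_ℂ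
        - ⟪σ (f (x i)) (ξ i), σ (f (x j)) (ξ j)⟫_ℂ := by
    intro i j
    rw [map_sub, ← Complex.coe_smul, map_smul, map_mul, map_star, sub_apply, inner_sub_right,
      smul_apply, inner_smul_right, mul_apply_eq_comp,
      ContinuousLinearMap.star_eq_adjoint,
      ContinuousLinearMap.adjoint_inner_right]
  simp only [e, Finset.sum_sub_distrib, ← Finset.mul_sum] at h
  rw [← form_sum_tmul] at h
  rw [← ofReal_norm_sum_sq] at h
  have h' := congrArg Complex.re h
  rw [Complex.sub_re, Complex.re_ofReal_mul, Complex.ofReal_re, Complex.ofReal_re] at h'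
  have h0 : 0 ≤ ∑ k, ‖∑ j, σ (R k j) (ξ j)‖ ^ 2 := by positivity
  linarith

/-- The operator `x ⊗ ξ ↦ f(x) ξ` on the algebraic tensor product. -/
noncomputable def liftₗ (f : SharpDual M E) : InteriorTensor σ E →ₗ[ℂ] K :=
  TensorProduct.lift (LinearMap.mk₂ ℂ (fun x ξ => σ (f x) ξ)
    (fun x y ξ => by
      have : f (x + y) = f x + f y := map_add f.1 x y
      simp [this])
    (fun c x ξ => by
      have : f (c • x) = c • f x := map_smul f.1 c x
      simp [this])
    (by intros; simp) (by intros; simp))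

@[simp] theorem liftₗ_tmul (f : SharpDual M E) (x : E) (ξ : K) :
    liftₗ σ f (tmul σ x ξ) = σ (f x) ξ := rfl

theorem norm_liftₗ_le (f : SharpDual M E) (z : InteriorTensor σ E) :
    ‖liftₗ σ f z‖ ≤ ‖f‖ * ‖z‖ := by
  obtain ⟨n, x, ξ, rfl⟩ := exists_eq_sum_tmul σ z
  refine le_of_sq_le_sq ?_ (by positivity)
  rw [mul_pow, norm_sq_eq, map_sum]
  exact norm_sum_apply_sq_le σ f x ξ

/-- The operator `1 ⊗ t` on the algebraic tensor product. -/
noncomputable def mapRightₗ (t : K →L[ℂ] K) : InteriorTensor σ E →ₗ[ℂ] InteriorTensor σ E :=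
  LinearMap.lTensor E (t : K →ₗ[ℂ] K)

@[simp] theorem mapRightₗ_tmul (t : K →L[ℂ] K) (x : E) (ξ : K) :
    mapRightₗ σ t (tmul σ x ξ) = tmul σ x (t ξ) := rfl

theorem norm_mapRightₗ_le (t : K →L[ℂ] K) (ht : ∀ m, t * σ m = σ m * t)
    (z : InteriorTensor σ E) : ‖mapRightₗ σ t z‖ ≤ ‖t‖ * ‖z‖ := by
  obtain ⟨n, x, ξ, rfl⟩ := exists_eq_sum_tmul σ z
  rw [map_sum]
  simp only [mapRightₗ_tmul]
  obtain ⟨R, hR⟩ := exists_form_eq_sum_norm_sq σ x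
  refine le_of_sq_le_sq ?_ (by positivity)
  rw [mul_pow, norm_sq_eq, norm_sq_eq, hR, hR ξ, Complex.ofReal_re,
    Complex.ofReal_re, Finset.mul_sum]
  refine Finset.sum_le_sum fun k _ => ?_
  have e2 : ∑ j, σ (R k j) (t (ξ j)) = t (∑ j, σ (R k j) (ξ j)) := by
    rw [map_sum]
    exact Finset.sum_congr rfl fun j _ => (DFunLike.congr_fun (ht (R k j)) (ξ j)).symm
  rw [e2, ← mul_pow]
  exact pow_le_pow_left₀ (norm_nonneg _) (t.le_opNorm _) 2

end InteriorTensor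

/-! ### Bounded module maps as operators -/

section Operators

variable {M K : Type*} [CStarAlgebra M] [PartialOrder M] [StarOrderedRing M]
  [NormedAddCommGroup K] [InnerProductSpace ℂ K] [CompleteSpace K] (σ : M →⋆ₐ[ℂ] (K →L[ℂ] K))
  (E : Type*) [NormedAddCommGroup E] [NormedSpace ℂ E] [SMul Mᵐᵒᵖ E] [PreHilbertModule M E]

/-- The interior tensor product `E ⊗_M K`, a Hilbert space. -/
abbrev InteriorHilbert : Type _ := Completion (InteriorTensor σ E)

variable {E}

namespace InteriorHilbert

/-- The elementary tensor `x ⊗ ξ` in the Hilbert space `E ⊗_M K`. -/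
noncomputable def tmul (x : E) (ξ : K) : InteriorHilbert σ E :=
  ((InteriorTensor.tmul σ x ξ : InteriorTensor σ E) : InteriorHilbert σ E)

theorem inner_tmul (x y : E) (ξ η : K) :
    ⟪tmul σ x ξ, tmul σ y η⟫_ℂ = ⟪ξ, σ (inner M x y) η⟫_ℂ := by
  rw [tmul, tmul, Completion.inner_coe, InteriorTensor.inner_tmul]

theorem norm_tmul_le (x : E) (ξ : K) : ‖tmul σ x ξ‖ ≤ ‖x‖ * ‖ξ‖ := by
  rw [tmul, Completion.norm_coe]
  exact InteriorTensor.norm_tmul_le σ x ξ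

theorem clm_ext {F : Type*} [NormedAddCommGroup F] [NormedSpace ℂ F]
    {S T : InteriorHilbert σ E →L[ℂ] F} (h : ∀ x ξ, S (tmul σ x ξ) = T (tmul σ x ξ)) :
    S = T := by
  ext z
  refine Completion.induction_on z (isClosed_eq S.continuous T.continuous) fun z => ?_
  induction z using InteriorTensor.induction with
  | h0 => rw [Completion.coe_zero, map_zero, map_zero]
  | ht x ξ => exact h x ξ
  | ha x y hx hy => rw [Completion.coe_add, map_add, map_add, hx, hy]

theorem ext_inner_tmul {v w : InteriorHilbert σ E}
    (h : ∀ x ξ, ⟪v, tmul σ x ξ⟫_ℂ = ⟪w, tmul σ x ξ⟫_ℂ) : v = w := by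
  have : innerSL ℂ v = innerSL ℂ w := clm_ext σ h
  exact ext_inner_right ℂ fun z => DFunLike.congr_fun this z

/-- The operator `1 ⊗ t` on `E ⊗_M K`, for `t` in the commutant of `M`. -/
noncomputable def mapRight (t : K →L[ℂ] K) (ht : ∀ m, t * σ m = σ m * t) :
    InteriorHilbert σ E →L[ℂ] InteriorHilbert σ E :=
  ((InteriorTensor.mapRightₗ σ t).mkContinuous ‖t‖
    (InteriorTensor.norm_mapRightₗ_le σ t ht)).completion

@[simp] theorem mapRight_tmul (t : K →L[ℂ] K) (ht : ∀ m, t * σ m = σ m * t) (x : E) (ξ : K) :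
    mapRight σ t ht (tmul σ x ξ) = tmul σ x (t ξ) := by
  rw [mapRight, tmul, ContinuousLinearMap.completion_apply_coe]
  rfl

theorem star_commute {t : K →L[ℂ] K} (ht : ∀ m, t * σ m = σ m * t) (m : M) :
    star t * σ m = σ m * star t := by
  have := congrArg star (ht (star m))
  simp only [star_mul, map_star, star_star] at this
  exact this.symm

theorem adjoint_mapRight (t : K →L[ℂ] K) (ht : ∀ m, t * σ m = σ m * t) :
    (mapRight σ (star t) (star_commute σ ht) : InteriorHilbert σ E →L[ℂ] _).adjoint
      = mapRight σ t ht := by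
  refine clm_ext σ fun x ξ => ext_inner_tmul σ fun y η => ?_
  rw [ContinuousLinearMap.adjoint_inner_left, mapRight_tmul, mapRight_tmul, inner_tmul,
    inner_tmul, ← mul_apply_eq_comp, ← star_commute σ ht, mul_apply_eq_comp,
    ContinuousLinearMap.star_eq_adjoint, ContinuousLinearMap.adjoint_inner_right]

end InteriorHilbert

namespace SharpDual

/-- The operator `S_f : E ⊗_M K → K`, `x ⊗ ξ ↦ f(x) ξ`, given by a bounded module map `f`. -/
noncomputable def toOp (f : SharpDual M E) : InteriorHilbert σ E →L[ℂ] K :=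
  ((InteriorTensor.liftₗ σ f).mkContinuous ‖f‖ (InteriorTensor.norm_liftₗ_le σ f)).fromCompletion

@[simp] theorem toOp_tmul (f : SharpDual M E) (x : E) (ξ : K) :
    toOp σ f (InteriorHilbert.tmul σ x ξ) = σ (f x) ξ := by
  rw [toOp, InteriorHilbert.tmul, ContinuousLinearMap.fromCompletion_apply_coe]
  rfl

theorem toOp_add (f g : SharpDual M E) : toOp σ (f + g) = toOp σ f + toOp σ g :=
  InteriorHilbert.clm_ext σ fun x ξ => by simp

theorem toOp_smul (c : ℂ) (f : SharpDual M E) : toOp σ (c • f) = star c • toOp σ f :=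
  InteriorHilbert.clm_ext σ fun x ξ => by simp

theorem toOp_act (f : SharpDual M E) (a : M) : toOp σ (f <• a) = star (σ a) ∘L toOp σ f :=
  InteriorHilbert.clm_ext σ fun x ξ => by simp [← map_star]

theorem toOp_comp_mapRight (f : SharpDual M E) (t : K →L[ℂ] K)
    (ht : ∀ m, t * σ m = σ m * t) :
    toOp σ f ∘L InteriorHilbert.mapRight σ t ht = t ∘L toOp σ f :=
  InteriorHilbert.clm_ext σ fun x ξ => by
    simpa using (DFunLike.congr_fun (ht (f x)) ξ).symm

theorem adjoint_toOp_toSharpDual (x : E) (ξ : K) :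
    (toOp σ (PreHilbertModule.toSharpDual M E x)).adjoint ξ = InteriorHilbert.tmul σ x ξ := by
  refine InteriorHilbert.ext_inner_tmul σ fun y η => ?_
  rw [ContinuousLinearMap.adjoint_inner_left, toOp_tmul, InteriorHilbert.inner_tmul,
    PreHilbertModule.toSharpDual_apply]

/-- The operator norm of `f` is that of `S_f`; one inequality is Paschke's. -/
theorem norm_toOp (hσ : Function.Injective σ) (f : SharpDual M E) : ‖toOp σ f‖ = ‖f‖ := by
  refine le_antisymm ?_ ?_
  · refine ContinuousLinearMap.opNorm_le_bound _ (norm_nonneg _) fun z => ?_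
    refine Completion.induction_on z (isClosed_le (by fun_prop) (by fun_prop)) fun z => ?_
    rw [toOp, ContinuousLinearMap.fromCompletion_apply_coe, Completion.norm_coe]
    exact InteriorTensor.norm_liftₗ_le σ f z
  · refine ContinuousLinearMap.opNorm_le_bound f.1 (norm_nonneg (toOp σ f)) fun x => ?_
    have h : ‖σ (f x)‖ ≤ ‖toOp σ f‖ * ‖x‖ := by
      refine ContinuousLinearMap.opNorm_le_bound _ (by positivity) fun ξ => ?_
      rw [← toOp_tmul, mul_assoc]
      exact (toOp σ f).le_of_opNorm_le_of_le le_rfl (InteriorHilbert.norm_tmul_le σ x ξ)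
    rwa [NonUnitalStarAlgHom.norm_map σ hσ] at h

/-- `S_f S_g⋆` commutes with the commutant of `M`. -/
theorem commute_toOp_comp_adjoint (f g : SharpDual M E) (t : K →L[ℂ] K)
    (ht : ∀ m, t * σ m = σ m * t) :
    t * (toOp σ f ∘L (toOp σ g).adjoint) = (toOp σ f ∘L (toOp σ g).adjoint) * t := by
  have h1 := congrArg ContinuousLinearMap.adjoint
    (toOp_comp_mapRight σ g (star t) (InteriorHilbert.star_commute σ ht))
  rw [ContinuousLinearMap.adjoint_comp, ContinuousLinearMap.adjoint_comp,
    InteriorHilbert.adjoint_mapRight σ t ht, ← ContinuousLinearMap.star_eq_adjoint (star t),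
    star_star] at h1
  change t ∘L _ = _ ∘L t
  rw [← ContinuousLinearMap.comp_assoc, ← toOp_comp_mapRight σ f t ht,
    ContinuousLinearMap.comp_assoc, h1, ContinuousLinearMap.comp_assoc]

end SharpDual

end Operators

/-! ### The inner product on the dual module -/

/-- Positivity is reflected by an injective representation: with `N` the negative part of `a`, the
operators `N T T⋆ N` and `-N³` coincide, and the former is
positive and the latter negative, so both are zero. -/
theorem nonneg_of_map_eq_comp_adjoint {M K L : Type*} [CStarAlgebra M] [PartialOrder M]
    [StarOrderedRing M] [NormedAddCommGroup K] [InnerProductSpace ℂ K] [CompleteSpace K]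
    [NormedAddCommGroup L] [InnerProductSpace ℂ L] [CompleteSpace L]
    {σ : M →⋆ₐ[ℂ] (K →L[ℂ] K)} (hσ : Function.Injective σ) {a : M} {T : L →L[ℂ] K}
    (h : σ a = T ∘L T.adjoint) : 0 ≤ a := by
  have ha : IsSelfAdjoint a := by
    refine hσ ?_
    rw [map_star, h, ContinuousLinearMap.star_eq_adjoint, ContinuousLinearMap.adjoint_comp,
      ContinuousLinearMap.adjoint_adjoint]
  obtain ⟨N, S, hNs, hS, h1, hfin⟩ := AlgExtension.exists_neg_part a ha
  have hSN : S * N = 0 := by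
    refine hσ (ContinuousLinearMap.ext fun ξ => ?_)
    have e := congrArg (fun b => (⟪ξ, σ b ξ⟫_ℂ).re) h1
    have e1 : ⟪ξ, σ (N * a * N) ξ⟫_ℂ = ⟪T.adjoint (σ N ξ), T.adjoint (σ N ξ)⟫_ℂ := by
      rw [ContinuousLinearMap.adjoint_inner_left]
      rw [mul_assoc, map_mul, map_mul, h, ← congrArg σ hNs, map_star, mul_apply_eq_comp,
        ContinuousLinearMap.star_eq_adjoint, ContinuousLinearMap.adjoint_inner_right,
        ← ContinuousLinearMap.star_eq_adjoint, ← map_star, hNs]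
      rfl
    have e2 : ⟪ξ, σ (-(star (S * N) * (S * N))) ξ⟫_ℂ = -⟪σ (S * N) ξ, σ (S * N) ξ⟫_ℂ := by
      rw [map_neg, neg_apply, inner_neg_right, map_mul σ (star _), map_star, mul_apply_eq_comp,
        ContinuousLinearMap.star_eq_adjoint, ContinuousLinearMap.adjoint_inner_right]
    simp only [e1, e2, Complex.neg_re] at e
    have h3 : 0 ≤ (⟪T.adjoint (σ N ξ), T.adjoint (σ N ξ)⟫_ℂ).re :=
      inner_self_nonneg (𝕜 := ℂ)
    have h4 : 0 ≤ (⟪σ (S * N) ξ, σ (S * N) ξ⟫_ℂ).re := inner_self_nonneg (𝕜 := ℂ)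
    have h5 : (⟪σ (S * N) ξ, σ (S * N) ξ⟫_ℂ).re ≤ 0 := by linarith
    rw [map_zero, zero_apply]
    rw [← norm_eq_zero, ← sq_eq_zero_iff, ← inner_self_eq_norm_sq (𝕜 := ℂ)]
    exact le_antisymm h5 h4
  have hNN : star N * N = 0 := by
    have : N * N = star S * (S * N) := by rw [← mul_assoc, ← hS]
    rw [hNs, this, hSN, mul_zero]
  obtain ⟨R, rfl⟩ := hfin ((CStarRing.star_mul_self_eq_zero_iff _).mp hNN)
  exact star_mul_self_nonneg R

namespace SharpDual

instance {M E : Type*} [NonUnitalCStarAlgebra M]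
    [NormedAddCommGroup E] [NormedSpace ℂ E] [SMul Mᵐᵒᵖ E] : CompleteSpace (SharpDual M E) := by
  have hc : IsClosed (moduleMaps M E : Set (E →L[ℂ] M)) := by
    have : (moduleMaps M E : Set (E →L[ℂ] M))
        = ⋂ (x : E), ⋂ (a : M), {f | f (x <• a) = f x * a} := by
      ext f
      simp [moduleMaps]
    rw [this]
    refine isClosed_iInter fun x => isClosed_iInter fun a => isClosed_eq ?_ ?_
    · fun_prop
    · fun_prop
  exact hc.completeSpace_coe

section Precomp

variable {M E F : Type*} [NonUnitalCStarAlgebra M]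
  [NormedAddCommGroup E] [NormedSpace ℂ E] [SMul Mᵐᵒᵖ E]
  [NormedAddCommGroup F] [NormedSpace ℂ F] [SMul Mᵐᵒᵖ F]

/-- The map `F^♯ → E^♯` dual to a bounded module map `u : E → F`. -/
noncomputable def precomp (u : E →L[ℂ] F) (hu : ∀ (x : E) (a : M), u (x <• a) = u x <• a) :
    SharpDual M F →L[ℂ] SharpDual M E :=
  LinearMap.mkContinuous
    { toFun f := ⟨f.1.comp u, fun x a => by
        change f (u (x <• a)) = f (u x) * a
        rw [hu, map_act]⟩
      map_add' f g := rfl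
      map_smul' c f := rfl } ‖u‖ fun f => by
    rw [mul_comm]
    exact f.1.opNorm_comp_le u

@[simp] theorem precomp_apply (u : E →L[ℂ] F) (hu : ∀ (x : E) (a : M), u (x <• a) = u x <• a)
    (f : SharpDual M F) (x : E) : precomp u hu f x = f (u x) := rfl

end Precomp

section Hat

variable {M : Type*} (E : Type*) [NonUnitalCStarAlgebra M] [PartialOrder M] [StarOrderedRing M]
  [NormedAddCommGroup E] [NormedSpace ℂ E] [SMul Mᵐᵒᵖ E] [PreHilbertModule M E]

variable (M) in
/-- The canonical map `E → E^♯`, `x ↦ ⟨x, ·⟩`, as a continuous linear map. -/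
noncomputable def hat : E →L[ℂ] SharpDual M E :=
  (PreHilbertModule.toSharpDual M E).mkContinuous 1 fun x => by
    rw [one_mul]
    exact ContinuousLinearMap.opNorm_le_bound _ (norm_nonneg x) fun y =>
      PreHilbertModule.norm_inner_le x y

theorem hat_apply (x y : E) : hat M E x y = inner M x y := rfl

theorem toSharpDual_eq_hat (x : E) : PreHilbertModule.toSharpDual M E x = hat M E x := rfl

theorem hat_act (x : E) (a : M) : hat M E (x <• a) = hat M E x <• a := by
  ext y
  exact PreHilbertModule.inner_act_left x y a

end Hat

section InnerProduct

variable {M K : Type*} [CStarAlgebra M] [PartialOrder M] [StarOrderedRing M]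
  [NormedAddCommGroup K] [InnerProductSpace ℂ K] [CompleteSpace K] {σ : M →⋆ₐ[ℂ] (K →L[ℂ] K)}
  (hσ : Function.Injective σ)
  (hbic : ∀ T : K →L[ℂ] K, (∀ t : K →L[ℂ] K, (∀ m, t * σ m = σ m * t) → t * T = T * t) →
    ∃ m, σ m = T)
  (E : Type*) [NormedAddCommGroup E] [NormedSpace ℂ E] [SMul Mᵐᵒᵖ E] [PreHilbertModule M E]

variable {E} in
/-- The inner product `⟨f, g⟩ = S_f S_g⋆` of two bounded module maps; it lies in `M` because it
commutes with the commutant of `M`. -/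
noncomputable def innerOp (f g : SharpDual M E) : M :=
  (hbic (toOp σ f ∘L (toOp σ g).adjoint) (commute_toOp_comp_adjoint σ f g)).choose

variable {E} in
theorem map_innerOp (f g : SharpDual M E) :
    σ (innerOp hbic f g) = toOp σ f ∘L (toOp σ g).adjoint :=
  (hbic (toOp σ f ∘L (toOp σ g).adjoint) (commute_toOp_comp_adjoint σ f g)).choose_spec

/-- The dual module of a pre-Hilbert module over a von Neumann algebra is a pre-Hilbert module,
with the inner product `⟨f, g⟩ = S_f S_g⋆`. -/
@[reducible] noncomputable def preHilbertModule : PreHilbertModule M (SharpDual M E) where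
  inner f g := innerOp hbic f g
  add_act f g a := by ext x; simp [mul_add]
  act_add f a b := by ext x; simp only [act_apply, add_apply, star_add, add_mul]
  act_mul f a b := by ext x; simp only [act_apply, star_mul, mul_assoc]
  smul_act c f a := by ext x; simp
  act_smul c f a := by ext x; simp only [act_apply, smul_apply, star_smul, smul_mul_assoc]
  inner_add_right f g h := hσ <| by
    simp only [map_add, map_innerOp, toOp_add, ContinuousLinearMap.comp_add]
  inner_smul_right c f g := hσ <| by
    simp only [map_smul, map_innerOp, toOp_smul, LinearIsometryEquiv.map_smulₛₗ,
      ContinuousLinearMap.comp_smul]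
    simp
  inner_act_right f g a := hσ <| by
    simp only [map_mul, map_innerOp, toOp_act, ContinuousLinearMap.adjoint_comp,
      ContinuousLinearMap.star_eq_adjoint, ContinuousLinearMap.adjoint_adjoint]
    rfl
  star_inner f g := hσ <| by
    simp only [map_star, map_innerOp, ContinuousLinearMap.star_eq_adjoint,
      ContinuousLinearMap.adjoint_comp, ContinuousLinearMap.adjoint_adjoint]
  inner_self_nonneg f := nonneg_of_map_eq_comp_adjoint hσ (map_innerOp hbic f f)
  eq_zero_of_inner_self f hf := by
    have h := map_innerOp hbic f f
    rw [hf, map_zero] at h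
    have h2 := ContinuousLinearMap.norm_adjoint_comp_self (toOp σ f).adjoint
    rw [ContinuousLinearMap.adjoint_adjoint, ← h, norm_zero, LinearIsometryEquiv.norm_map,
      norm_toOp σ hσ] at h2
    simpa using h2.symm
  norm_sq_eq f := by
    have h2 := ContinuousLinearMap.norm_adjoint_comp_self (toOp σ f).adjoint
    rw [ContinuousLinearMap.adjoint_adjoint, ← map_innerOp hbic, LinearIsometryEquiv.norm_map,
      norm_toOp σ hσ, NonUnitalStarAlgHom.norm_map σ hσ] at h2
    rw [h2, sq]

variable {E} in
theorem innerOp_hat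
    (hσ : Function.Injective σ)
    (hbic : ∀ T : K →L[ℂ] K, (∀ t : K →L[ℂ] K, (∀ m, t * σ m = σ m * t) → t * T = T * t) →
      ∃ m, σ m = T)
    (f : SharpDual M E) (x : E) : innerOp hbic f (hat M E x) = f x := by
  refine hσ (ContinuousLinearMap.ext fun ξ => ?_)
  rw [map_innerOp, ContinuousLinearMap.comp_apply, ← toSharpDual_eq_hat,
    adjoint_toOp_toSharpDual, toOp_tmul]

variable {E}

/-- A bounded module map on `E^♯` that vanishes on `E` is zero.  Indeed `E ⊗_M K` is dense in
`E^♯ ⊗_M K`: the isometry `g ⊗ ξ ↦ S_g⋆ ξ` maps `E^♯ ⊗_M K` to `E ⊗_M K` and restricts to the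
identity there. -/
theorem eq_zero_of_comp_hat_eq_zero
    (hσ : Function.Injective σ)
    (hbic : ∀ T : K →L[ℂ] K, (∀ t : K →L[ℂ] K, (∀ m, t * σ m = σ m * t) → t * T = T * t) →
      ∃ m, σ m = T)
    (F : SharpDual M (SharpDual M E))
    (hF : ∀ x : E, F (hat M E x) = 0) : F = 0 := by
  let _ := preHilbertModule hσ hbic E
  let W : InteriorTensor σ (SharpDual M E) →ₗ[ℂ] InteriorHilbert σ E :=
    TensorProduct.lift (LinearMap.mk₂ ℂ (fun g ξ => (toOp σ g).adjoint ξ)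
      (fun f g ξ => by rw [toOp_add, map_add, _root_.add_apply])
      (fun c f ξ => by
        rw [toOp_smul, LinearIsometryEquiv.map_smulₛₗ]
        simp)
      (by intros; simp) (by intros; simp))
  have hWt : ∀ g ξ, W (InteriorTensor.tmul σ g ξ) = (toOp σ g).adjoint ξ := fun g ξ => rfl
  have hWi : ∀ z w, ⟪W z, W w⟫_ℂ = InteriorTensor.form σ (SharpDual M E) z w := by
    intro z w
    induction z using InteriorTensor.induction with
    | h0 => simp
    | ha x y hx hy => rw [map_add, inner_add_left, hx, hy, map_add, LinearMap.add_apply]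
    | ht f ξ =>
      induction w using InteriorTensor.induction with
      | h0 => simp
      | ha x y hx hy => rw [map_add, inner_add_right, hx, hy, map_add]
      | ht g η =>
        rw [hWt, hWt, ContinuousLinearMap.adjoint_inner_left, InteriorTensor.form_tmul]
        change _ = ⟪ξ, σ (innerOp hbic f g) η⟫_ℂ
        rw [map_innerOp, ContinuousLinearMap.comp_apply]
  have hWn : ∀ z, ‖z‖ = ‖W z‖ := by
    intro z
    refine (sq_eq_sq₀ (norm_nonneg _) (norm_nonneg _)).mp ?_
    rw [InteriorTensor.norm_sq_eq, ← hWi, ← inner_self_eq_norm_sq (𝕜 := ℂ)]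
    rfl
  -- The tensors `x ⊗ ξ` with `x` in `E` lift through `W` to the kernel of the operator of `F`.
  have hlift : ∀ z : InteriorTensor σ E, ∃ z' : InteriorTensor σ (SharpDual M E),
      W z' = (z : InteriorHilbert σ E) ∧ InteriorTensor.liftₗ σ F z' = 0 := by
    intro z
    induction z using InteriorTensor.induction with
    | h0 => exact ⟨0, by rw [map_zero, Completion.coe_zero], map_zero _⟩
    | ht x ξ =>
      refine ⟨InteriorTensor.tmul σ (hat M E x) ξ, ?_, ?_⟩
      · rw [hWt, ← toSharpDual_eq_hat, adjoint_toOp_toSharpDual]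
        rfl
      · rw [InteriorTensor.liftₗ_tmul, hF, map_zero, _root_.zero_apply]
    | ha x y hx hy =>
      obtain ⟨x', hx1, hx2⟩ := hx
      obtain ⟨y', hy1, hy2⟩ := hy
      exact ⟨x' + y', by rw [map_add, hx1, hy1, Completion.coe_add],
        by rw [map_add, hx2, hy2, add_zero]⟩
  -- Approximate `g ⊗ ξ` by elements of `E ⊗ K`, on which the operator of `F` vanishes.
  ext g
  refine hσ (ContinuousLinearMap.ext fun ξ => ?_)
  rw [zero_apply, map_zero, _root_.zero_apply, ← InteriorTensor.liftₗ_tmul, ← norm_le_zero_iff]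
  refine le_of_forall_pos_le_add fun ε hε => ?_
  rw [zero_add]
  have hδ : 0 < ε / (‖F‖ + 1) := by positivity
  obtain ⟨_, hz, ⟨z, rfl⟩⟩ := Metric.dense_iff.mp
    (Completion.denseRange_coe (α := InteriorTensor σ E)) ((toOp σ g).adjoint ξ) _ hδ
  obtain ⟨z', hz1, hz2⟩ := hlift z
  have hsub : InteriorTensor.liftₗ σ F (InteriorTensor.tmul σ g ξ)
      = InteriorTensor.liftₗ σ F (InteriorTensor.tmul σ g ξ - z') := by
    rw [map_sub, hz2, sub_zero]
  have hdist : ‖InteriorTensor.tmul σ g ξ - z'‖ ≤ ε / (‖F‖ + 1) := by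
    rw [hWn, map_sub, hz1, hWt, ← dist_eq_norm, dist_comm]
    exact (Metric.mem_ball.mp hz).le
  rw [hsub]
  calc ‖InteriorTensor.liftₗ σ F (InteriorTensor.tmul σ g ξ - z')‖
      ≤ ‖F‖ * ‖InteriorTensor.tmul σ g ξ - z'‖ := InteriorTensor.norm_liftₗ_le σ F _
    _ ≤ (‖F‖ + 1) * (ε / (‖F‖ + 1)) := by gcongr; linarith
    _ = ε := by field_simp

/-- **Self-duality of `E^♯`.** -/
theorem isSelfDual_sharpDual
    (hσ : Function.Injective σ)
    (hbic : ∀ T : K →L[ℂ] K, (∀ t : K →L[ℂ] K, (∀ m, t * σ m = σ m * t) → t * T = T * t) →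
      ∃ m, σ m = T) :
    @IsSelfDual M (SharpDual M E) _ _ _ _ _ (preHilbertModule hσ hbic E) := by
  let _ := preHilbertModule hσ hbic E
  intro F
  let f := precomp (hat M E) (hat_act E) F
  refine ⟨f, fun g => ?_⟩
  have h : F - hat M (SharpDual M E) f = 0 := by
    refine eq_zero_of_comp_hat_eq_zero hσ hbic _ fun x => ?_
    change F (hat M E x) - innerOp hbic f (hat M E x) = 0
    rw [innerOp_hat hσ, precomp_apply, sub_self]
  rw [sub_eq_zero.mp h]
  rfl

end InnerProduct

end SharpDual

/-! ### Self-dual modules and embeddings -/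

namespace PreHilbertModule

variable {M E F : Type*} [NonUnitalCStarAlgebra M] [PartialOrder M]
  [NormedAddCommGroup E] [NormedSpace ℂ E] [SMul Mᵐᵒᵖ E] [PreHilbertModule M E]
  [NormedAddCommGroup F] [NormedSpace ℂ F] [SMul Mᵐᵒᵖ F] [PreHilbertModule M F]

theorem inner_sub_left (x y z : E) : inner M (x - y) z = inner M x z - inner M y z := by
  simp only [← innerₛₗ_apply, map_sub, LinearMap.sub_apply]

theorem inner_sub_right (x y z : E) : inner M x (y - z) = inner M x y - inner M x z := by
  simp only [← innerₛₗ_apply, map_sub]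

variable (M) in
theorem ext_inner {x y : E} (h : ∀ z, inner M x z = inner M y z) : x = y := by
  refine sub_eq_zero.mp (eq_zero_of_inner_self (A := M) _ ?_)
  rw [inner_sub_left, h, sub_self]

variable (M) in
theorem norm_eq_of_inner_self_eq {x : E} {y : F} (h : inner M x x = inner M y y) : ‖x‖ = ‖y‖ := by
  refine (sq_eq_sq₀ (norm_nonneg _) (norm_nonneg _)).mp ?_
  rw [norm_sq_eq (A := M), norm_sq_eq (A := M), h]

theorem norm_act_le (x : E) (a : M) : ‖x <• a‖ ≤ ‖a‖ * ‖x‖ := by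
  refine le_of_sq_le_sq ?_ (by positivity)
  rw [norm_sq_eq (A := M), inner_act_right, inner_act_left, mul_pow, norm_sq_eq (A := M) x]
  calc ‖star a * inner M x x * a‖ ≤ ‖star a‖ * ‖(inner M x x : M)‖ * ‖a‖ :=
        (norm_mul_le _ _).trans (mul_le_mul_of_nonneg_right (norm_mul_le _ _) (norm_nonneg _))
    _ = ‖a‖ ^ 2 * ‖(inner M x x : M)‖ := by rw [norm_star]; ring

theorem continuous_act (a : M) : Continuous fun x : E => x <• a :=
  (LinearMap.mkContinuous (⟨⟨fun x : E => x <• a, fun x y => add_act x y a⟩,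
    fun c x => smul_act c x a⟩ : E →ₗ[ℂ] E) ‖a‖ fun x => norm_act_le x a).continuous

theorem zero_act (a : M) : (0 : E) <• a = 0 := by
  have h := add_act (0 : E) 0 a
  rw [add_zero] at h
  exact (left_eq_add (a := (0 : E) <• a)).mp h

theorem continuous_inner [StarOrderedRing M] {X : Type*} [TopologicalSpace X] {f g : X → E}
    (hf : Continuous f) (hg : Continuous g) : Continuous fun t => inner M (f t) (g t) :=
  (((innerₛₗ (A := M) (E := E)).mkContinuous₂ 1 fun x y => by
    rw [one_mul]
    exact norm_inner_le x y).continuous.comp hf).clm_apply hg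

theorem act_one {B G : Type*} [CStarAlgebra B] [PartialOrder B] [NormedAddCommGroup G]
    [NormedSpace ℂ G] [SMul Bᵐᵒᵖ G] [PreHilbertModule B G] (x : G) : x <• (1 : B) = x :=
  ext_inner B fun z => by rw [inner_act_left, star_one, one_mul]

end PreHilbertModule

section SelfDual

variable {M E F : Type*} [NonUnitalCStarAlgebra M] [PartialOrder M] [StarOrderedRing M]
  [NormedAddCommGroup E] [NormedSpace ℂ E] [SMul Mᵐᵒᵖ E] [PreHilbertModule M E]
  [NormedAddCommGroup F] [NormedSpace ℂ F] [SMul Mᵐᵒᵖ F] [PreHilbertModule M F]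

/-- The inverse of `F → F^♯` for a self-dual module `F`. -/
noncomputable def IsSelfDual.riesz (hF : IsSelfDual M F) : SharpDual M F →ₗ[ℂ] F where
  toFun f := (hF f).choose
  map_add' f g := PreHilbertModule.ext_inner M fun y => by
    rw [PreHilbertModule.inner_add_left, ← (hF (f + g)).choose_spec, ← (hF f).choose_spec,
      ← (hF g).choose_spec, SharpDual.add_apply]
  map_smul' c f := PreHilbertModule.ext_inner M fun y => by
    rw [RingHom.id_apply, PreHilbertModule.inner_smul_left, ← (hF (c • f)).choose_spec,
      ← (hF f).choose_spec, SharpDual.smul_apply]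

theorem IsSelfDual.inner_riesz (hF : IsSelfDual M F) (f : SharpDual M F) (y : F) :
    inner M (hF.riesz f) y = f y :=
  ((hF f).choose_spec y).symm

theorem IsHilbertEmbedding.inner_eq {j : E →ₗ[ℂ] F}
    (hj : IsHilbertEmbedding (NonUnitalStarAlgHom.id ℂ M) j) (x y : E) :
    inner M (j x) (j y) = inner M x y := hj.inner_map x y

/-- A map of Hilbert modules that preserves inner products, as a continuous linear map. -/
noncomputable def IsHilbertEmbedding.toCLM {j : E →ₗ[ℂ] F}
    (hj : IsHilbertEmbedding (NonUnitalStarAlgHom.id ℂ M) j) : E →L[ℂ] F :=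
  j.mkContinuous 1 fun x => by
    rw [one_mul]
    exact (PreHilbertModule.norm_eq_of_inner_self_eq M (hj.inner_eq x x)).le

theorem IsHilbertEmbedding.toCLM_apply {j : E →ₗ[ℂ] F}
    (hj : IsHilbertEmbedding (NonUnitalStarAlgHom.id ℂ M) j) (x : E) : hj.toCLM x = j x := rfl

theorem IsHilbertEmbedding.toCLM_act {j : E →ₗ[ℂ] F}
    (hj : IsHilbertEmbedding (NonUnitalStarAlgHom.id ℂ M) j) (x : E) (a : M) :
    hj.toCLM (x <• a) = hj.toCLM x <• a := hj.map_act x a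

/-- The image of a self-dual module under an embedding is an orthogonal summand: the projection of
`y` is the image of the vector representing `x ↦ ⟨y, j x⟩`. -/
theorem IsSelfDual.isOrthogonalSummand_range (hE : IsSelfDual M E) {j : E →ₗ[ℂ] F}
    (hj : IsHilbertEmbedding (NonUnitalStarAlgHom.id ℂ M) j) :
    IsOrthogonalSummand M (LinearMap.range j) := by
  intro y
  refine ⟨j (hE.riesz (SharpDual.precomp hj.toCLM hj.toCLM_act (SharpDual.hat M F y))),
    ⟨_, rfl⟩, ?_⟩
  rintro _ ⟨x, rfl⟩
  rw [PreHilbertModule.inner_sub_left, hj.inner_eq,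
    hE.inner_riesz, SharpDual.precomp_apply, SharpDual.hat_apply, IsHilbertEmbedding.toCLM_apply,
    sub_self]

variable [PreHilbertModule M (SharpDual M E)]

/-- An embedding of `E^♯` is determined by its restriction to `E`.  For `f` in `E^♯` the bounded
module map `g ↦ ⟨j' f, j g⟩` is of the form `⟨f', ·⟩`, and evaluation on `E` gives `f' = f`. -/
theorem IsHilbertEmbedding.eq_of_hat
    (hhat : ∀ (f : SharpDual M E) (x : E), inner M f (SharpDual.hat M E x) = f x)
    (hE : IsSelfDual M (SharpDual M E)) {j j' : SharpDual M E →ₗ[ℂ] F}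
    (hj : IsHilbertEmbedding (NonUnitalStarAlgHom.id ℂ M) j)
    (hj' : IsHilbertEmbedding (NonUnitalStarAlgHom.id ℂ M) j')
    (h : ∀ x : E, j' (SharpDual.hat M E x) = j (SharpDual.hat M E x)) : j' = j := by
  have key : ∀ f g, inner M (j' f) (j g) = inner M f g := by
    intro f g
    obtain ⟨f', hf'⟩ := hE (SharpDual.precomp hj.toCLM hj.toCLM_act (SharpDual.hat M F (j' f)))
    have hff' : f' = f := by
      ext x
      rw [← hhat f', ← hf', SharpDual.precomp_apply, SharpDual.hat_apply,
        IsHilbertEmbedding.toCLM_apply, ← h, hj'.inner_eq, hhat]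
    rw [← hff', ← hf', SharpDual.precomp_apply, SharpDual.hat_apply,
      IsHilbertEmbedding.toCLM_apply, hff']
  ext f
  refine sub_eq_zero.mp (PreHilbertModule.eq_zero_of_inner_self (A := M) _ ?_)
  have key' : inner M (j f) (j' f) = inner M f f := by
    rw [← PreHilbertModule.star_inner, key, PreHilbertModule.star_inner]
  rw [PreHilbertModule.inner_sub_left, PreHilbertModule.inner_sub_right,
    PreHilbertModule.inner_sub_right, hj.inner_eq, hj'.inner_eq, key, key']
  simp

/-- An embedding `i` of `E` in a self-dual module `F` extends to `E^♯`.  The extension is the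
adjoint of `F → E^♯`, `y ↦ ⟨y, i ·⟩`. -/
theorem IsSelfDual.exists_extension
    (hhat : ∀ (f : SharpDual M E) (x : E), inner M f (SharpDual.hat M E x) = f x)
    (hF : IsSelfDual M F) {i : E →ₗ[ℂ] F}
    (hi : IsHilbertEmbedding (NonUnitalStarAlgHom.id ℂ M) i) :
    ∃ j : SharpDual M E →ₗ[ℂ] F, IsHilbertEmbedding (NonUnitalStarAlgHom.id ℂ M) j ∧
      ∀ x, j (SharpDual.hat M E x) = i x := by
  let r : F →L[ℂ] SharpDual M E :=
    SharpDual.precomp hi.toCLM hi.toCLM_act ∘L SharpDual.hat M F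
  have hr : ∀ y x, r y x = inner M y (i x) := fun y x => rfl
  have hract : ∀ (y : F) (a : M), r (y <• a) = r y <• a := by
    intro y a
    ext x
    exact PreHilbertModule.inner_act_left y (i x) a
  have hri : ∀ x, r (i x) = SharpDual.hat M E x := by
    intro x
    ext y
    rw [hr, hi.inner_eq, SharpDual.hat_apply]
  let j : SharpDual M E →ₗ[ℂ] F := hF.riesz ∘ₗ
    (SharpDual.precomp r hract ∘L SharpDual.hat M (SharpDual M E) :
      SharpDual M E →L[ℂ] SharpDual M F).toLinearMap
  have hj : ∀ f y, inner M (j f) y = inner M f (r y) := fun f y => hF.inner_riesz _ y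
  have hrj : ∀ f, r (j f) = f := by
    intro f
    ext x
    rw [hr, hj, hri, hhat]
  refine ⟨j, ⟨fun f a => PreHilbertModule.ext_inner M fun y => ?_, fun f g => ?_⟩, fun x =>
    PreHilbertModule.ext_inner M fun y => ?_⟩
  · change inner M (j (f <• a)) y = inner M (j f <• a) y
    rw [hj, PreHilbertModule.inner_act_left, PreHilbertModule.inner_act_left, hj]
  · rw [hj, hrj]
    rfl
  · rw [hj, ← PreHilbertModule.star_inner, hhat, hr, PreHilbertModule.star_inner]

end SelfDual

/-! ### Maps out of `H • B` -/

namespace HilbertExtension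

variable {A B H F : Type*} [NonUnitalCStarAlgebra A] [PartialOrder A] [StarOrderedRing A]
  [CStarAlgebra B] [PartialOrder B] [StarOrderedRing B] (φ : A →⋆ₙₐ[ℂ] B)
  [NormedAddCommGroup H] [NormedSpace ℂ H] [SMul Aᵐᵒᵖ H] [PreHilbertModule A H]
  [NormedAddCommGroup F] [NormedSpace ℂ F] [SMul Bᵐᵒᵖ F] [PreHilbertModule B F]

/-- `H • B` is generated by `H` as a Hilbert `B`-module. -/
theorem ext_ofModule {u v : HilbertExtension φ H →L[ℂ] F}
    (hu : ∀ (x : HilbertExtension φ H) (b : B), u (x <• b) = u x <• b)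
    (hv : ∀ (x : HilbertExtension φ H) (b : B), v (x <• b) = v x <• b)
    (h : ∀ x : H, u (ofModule φ H x) = v (ofModule φ H x)) : u = v := by
  ext z
  refine Completion.induction_on z (isClosed_eq u.continuous v.continuous) fun z => ?_
  induction z using AlgExtension.induction with
  | h0 => rw [Completion.coe_zero, map_zero, map_zero]
  | ha x y hx hy => rw [Completion.coe_add, map_add, map_add, hx, hy]
  | ht x b =>
    have e : ((AlgExtension.tmul φ x b : AlgExtension φ H) : HilbertExtension φ H)
        = ofModule φ H x <• b := by
      rw [ofModule, LinearMap.coe_mk, AddHom.coe_mk, ← coe_act, AlgExtension.act_tmul, one_mul]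
    rw [e, hu, hv, h]

/-- The canonical map of `H` to `H • B` is an embedding of Hilbert modules. -/
theorem isHilbertEmbedding_ofModule : IsHilbertEmbedding φ (ofModule φ H) where
  inner_map x y := by
    change inner B ((AlgExtension.tmul φ x 1 : AlgExtension φ H) : HilbertExtension φ H)
      ((AlgExtension.tmul φ y 1 : AlgExtension φ H) : HilbertExtension φ H) = _
    rw [inner_coe, AlgExtension.form_tmul, star_one, one_mul, mul_one]
  map_act x a := PreHilbertModule.ext_inner B fun z => by
    change inner B ((AlgExtension.tmul φ (x <• a) 1 : AlgExtension φ H) : HilbertExtension φ H) z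
      = inner B (((AlgExtension.tmul φ x 1 : AlgExtension φ H) : HilbertExtension φ H) <• φ a) z
    refine Completion.induction_on z (isClosed_eq
      (continuous_inner φ continuous_const continuous_id)
      (continuous_inner φ continuous_const continuous_id)) fun z => ?_
    rw [← coe_act, inner_coe, inner_coe]
    induction z using AlgExtension.induction with
    | h0 => rw [map_zero, map_zero]
    | ha x y hx hy => rw [map_add, map_add, hx, hy]
    | ht y b =>
      rw [AlgExtension.act_tmul, AlgExtension.form_tmul, AlgExtension.form_tmul, one_mul,
        PreHilbertModule.inner_act_left, map_mul, map_star, star_one, one_mul]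

/-- The linear map `x ⊗ b ↦ ι(x) b` on the algebraic tensor product `H ⊗ B`. -/
noncomputable def liftAlg (ι : H →ₗ[ℂ] F) : AlgExtension φ H →ₗ[ℂ] F :=
  TensorProduct.lift (LinearMap.mk₂ ℂ (fun x (b : B) => ι x <• b)
    (fun x y b => by rw [map_add, PreHilbertModule.add_act])
    (fun c x b => by rw [map_smul, PreHilbertModule.smul_act])
    (fun x a b => PreHilbertModule.act_add _ _ _)
    (fun c x b => PreHilbertModule.act_smul _ _ _))

theorem liftAlg_tmul (ι : H →ₗ[ℂ] F) (x : H) (b : B) :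
    liftAlg φ ι (AlgExtension.tmul φ x b) = ι x <• b := rfl

variable {φ}

theorem inner_liftAlg {ι : H →ₗ[ℂ] F} (hι : IsHilbertEmbedding φ ι) (z w : AlgExtension φ H) :
    inner B (liftAlg φ ι z) (liftAlg φ ι w) = AlgExtension.form φ H z w := by
  rw [← PreHilbertModule.innerₛₗ_apply]
  induction z using AlgExtension.induction with
  | h0 => simp
  | ha x y hx hy => rw [map_add, map_add, LinearMap.add_apply, hx, hy, map_add, LinearMap.add_apply]
  | ht x a =>
    induction w using AlgExtension.induction with
    | h0 => simp
    | ha x y hx hy => rw [map_add, map_add, hx, hy, map_add]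
    | ht y b =>
      rw [liftAlg_tmul, liftAlg_tmul, PreHilbertModule.innerₛₗ_apply,
        PreHilbertModule.inner_act_right, PreHilbertModule.inner_act_left, hι.inner_map,
        AlgExtension.form_tmul]

/-- An embedding of `H` in a Hilbert `B`-module extends to `H • B`. -/
theorem exists_extension [CompleteSpace F] {ι : H →ₗ[ℂ] F} (hι : IsHilbertEmbedding φ ι) :
    ∃ i : HilbertExtension φ H →ₗ[ℂ] F, IsHilbertEmbedding (NonUnitalStarAlgHom.id ℂ B) i ∧
      ∀ x, i (ofModule φ H x) = ι x := by
  let i : HilbertExtension φ H →L[ℂ] F :=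
    ((liftAlg φ ι).mkContinuous 1 fun z => by
      rw [one_mul]
      refine le_of_sq_le_sq ?_ (norm_nonneg z)
      rw [PreHilbertModule.norm_sq_eq (A := B), inner_liftAlg hι,
        AlgExtension.norm_sq_eq]).fromCompletion
  have hi : ∀ z : AlgExtension φ H, i (z : HilbertExtension φ H) = liftAlg φ ι z := fun z =>
    ContinuousLinearMap.fromCompletion_apply_coe _ z
  have hcont : ∀ x y : HilbertExtension φ H, inner B (i x) (i y) = inner B x y := by
    intro x y
    refine Completion.induction_on₂ x y (isClosed_eq
      (PreHilbertModule.continuous_inner (i.continuous.comp continuous_fst)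
        (i.continuous.comp continuous_snd))
      (continuous_inner φ continuous_fst continuous_snd)) fun z w => ?_
    rw [hi, hi, inner_liftAlg hι, inner_coe]
  refine ⟨i, ⟨fun x b => ?_, hcont⟩, fun x => ?_⟩
  · change i (x <• b) = i x <• b
    refine Completion.induction_on x (isClosed_eq (i.continuous.comp (continuous_act φ b))
      ((PreHilbertModule.continuous_act b).comp i.continuous)) fun z => ?_
    rw [← coe_act, hi, hi]
    induction z using AlgExtension.induction with
    | h0 => rw [map_zero, map_zero, PreHilbertModule.zero_act]
    | ha x y hx hy => rw [map_add, map_add, hx, hy, map_add, PreHilbertModule.add_act]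
    | ht y a =>
      rw [AlgExtension.act_tmul, liftAlg_tmul, liftAlg_tmul, PreHilbertModule.act_mul]
  · change i (AlgExtension.tmul φ x 1 : AlgExtension φ H) = ι x
    rw [hi, liftAlg_tmul, PreHilbertModule.act_one]

end HilbertExtension

/-! ### The module `H^∼` over the bidual -/

section Bidual

variable (A : Type*) [NonUnitalCStarAlgebra A] [PartialOrder A] [StarOrderedRing A]

/-- The inclusion of the bidual in the operators on the space of the universal representation. -/
noncomputable def Bidual.inclusion :
    Bidual A →⋆ₐ[ℂ] (UniversalSpace A →L[ℂ] UniversalSpace A) :=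
  (bidualSubalgebra A).subtype

theorem Bidual.inclusion_injective : Function.Injective (Bidual.inclusion A) :=
  Subtype.val_injective

/-- The bidual is its own double commutant. -/
theorem Bidual.exists_inclusion_eq (T : UniversalSpace A →L[ℂ] UniversalSpace A)
    (hT : ∀ t : UniversalSpace A →L[ℂ] UniversalSpace A,
      (∀ m, t * Bidual.inclusion A m = Bidual.inclusion A m * t) → t * T = T * t) :
    ∃ m, Bidual.inclusion A m = T := by
  refine ⟨⟨T, (mem_bidualSubalgebra_iff A T).mpr fun t ht => hT t fun m => ?_⟩, rfl⟩
  exact (mem_bidualSubalgebra_iff A m.1).mp m.2 t ht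

end Bidual

theorem mainTheorem11 {A : Type u} [NonUnitalCStarAlgebra A] [PartialOrder A]
    [StarOrderedRing A] (H : Type v) [NormedAddCommGroup H] [NormedSpace ℂ H] [SMul Aᵐᵒᵖ H]
    [PreHilbertModule A H] [CompleteSpace H] :
    CompleteSpace (HSim A H) ∧
    ∃ _ : PreHilbertModule (Bidual A) (HSim A H),
      (∀ (f : HSim A H) (x : BidualExtension A H),
        inner (Bidual A) f (PreHilbertModule.toSharpDual (Bidual A) (BidualExtension A H) x)
          = f x) ∧
      IsSelfDual (Bidual A) (HSim A H) ∧
      IsHilbertEmbedding (toBidual A) (toHSim A H) ∧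
      ∀ (H₁ : Type w) [NormedAddCommGroup H₁] [NormedSpace ℂ H₁] [SMul (Bidual A)ᵐᵒᵖ H₁]
        [PreHilbertModule (Bidual A) H₁] [CompleteSpace H₁], IsSelfDual (Bidual A) H₁ →
        ∀ ι : H →ₗ[ℂ] H₁, IsHilbertEmbedding (toBidual A) ι →
          ∃ j : HSim A H →ₗ[ℂ] H₁,
            (IsHilbertEmbedding (NonUnitalStarAlgHom.id ℂ (Bidual A)) j ∧
              ∀ x : H, j (toHSim A H x) = ι x) ∧
            (∀ j' : HSim A H →ₗ[ℂ] H₁,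
              IsHilbertEmbedding (NonUnitalStarAlgHom.id ℂ (Bidual A)) j' →
              (∀ x : H, j' (toHSim A H x) = ι x) → j' = j) ∧
            IsOrthogonalSummand (Bidual A) (LinearMap.range j) := by
  let P : PreHilbertModule (Bidual A) (HSim A H) :=
    SharpDual.preHilbertModule (Bidual.inclusion_injective A) (Bidual.exists_inclusion_eq A)
      (BidualExtension A H)
  have hhat : ∀ (f : HSim A H) (x : BidualExtension A H),
      inner (Bidual A) f (SharpDual.hat (Bidual A) (BidualExtension A H) x) = f x :=
    SharpDual.innerOp_hat (Bidual.inclusion_injective A) (Bidual.exists_inclusion_eq A)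
  have hself : IsSelfDual (Bidual A) (HSim A H) :=
    SharpDual.isSelfDual_sharpDual (Bidual.inclusion_injective A) (Bidual.exists_inclusion_eq A)
  have htoHSim : ∀ x : H, toHSim A H x = SharpDual.hat (Bidual A) (BidualExtension A H)
      (HilbertExtension.ofModule (toBidual A) H x) := fun x => rfl
  have hof := HilbertExtension.isHilbertEmbedding_ofModule (H := H) (toBidual A)
  refine ⟨inferInstance, P, hhat, hself, ⟨fun x a => ?_, fun x y => ?_⟩, ?_⟩
  · rw [htoHSim, htoHSim, hof.map_act, SharpDual.hat_act]
  · rw [htoHSim, htoHSim, hhat, SharpDual.hat_apply, hof.inner_map]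
  · intro H₁ _ _ _ _ _ hH₁ ι hι
    obtain ⟨i, hi, hiι⟩ := HilbertExtension.exists_extension hι
    obtain ⟨j, hj, hji⟩ := hH₁.exists_extension hhat hi
    refine ⟨j, ⟨hj, fun x => ?_⟩, fun j' hj' hj'ι => ?_, hself.isOrthogonalSummand_range hj⟩
    · rw [htoHSim, hji, hiι]
    · refine hj.eq_of_hat hhat hself hj' fun x => ?_
      -- Both maps restrict to continuous module maps on `H • A**` that agree on `H`.
      have hcomp : hj'.toCLM ∘L SharpDual.hat (Bidual A) (BidualExtension A H)
          = hj.toCLM ∘L SharpDual.hat (Bidual A) (BidualExtension A H) := by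
        refine HilbertExtension.ext_ofModule (toBidual A) (fun x b => ?_) (fun x b => ?_)
          fun x => ?_
        · simp only [ContinuousLinearMap.comp_apply, SharpDual.hat_act, hj'.toCLM_act]
        · simp only [ContinuousLinearMap.comp_apply, SharpDual.hat_act, hj.toCLM_act]
        · simp only [ContinuousLinearMap.comp_apply, IsHilbertEmbedding.toCLM_apply, ← htoHSim]
          rw [hj'ι, htoHSim, hji, hiι]
      exact DFunLike.congr_fun hcomp x
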